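/- Let $n=d-1$, $m>0$, $\beta>0$ and $\vec v\in\mathbb R^{n}$ with $|\vec v|<1$. Let $\mu=(\vec p^{\,2}+m^2)^{1/2}$, $\mu_\pm=\mu\pm\vec p\cdot\vec v$ and $\rho_\pm=e^{-\beta\mu_\pm}(1-e^{-\beta\mu_\pm})^{-1}$ act by multiplication in Fourier space on the Sobolev space $\mathfrak h=\mathfrak H_{-1/2}(\mathbb R^{n})$ with inner product $\langle\alpha,\alpha'\rangle=\langle(2\mu)^{-1/2}\alpha,(2\mu)^{-1/2}\alpha'\rangle_{L_2}$. Let $\bar{\mathfrak h}$ be the complex conjugate Hilbert space (complex structure $-i$, inner product $\langle \bar x,\bar y\rangle_{\bar{\mathfrak h}}=\langle y,x\rangle_{\mathfrak h}$), where $x\mapsto\bar x$ is the canonical conjugate-linear bijection $\mathfrak h\to\bar{\mathfrak h}$. On $\mathcal H_1=\mathfrak h\oplus\bar{\mathfrak h}$ put $$\kappa_\pm(\alpha)=\bigl((1+\rho_\pm)^{1/2}\alpha,\ \overline{\rho_\pm^{1/2}\alpha}\bigr),\qquad \kappa'_\pm(\alpha)=\bigl(\rho_\pm^{1/2}\alpha,\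 \overline{(1+\rho_\pm)^{1/2}\alpha}\bigr),$$ $$e^{is\ell_\pm}(x,\bar y)=\bigl(e^{is\mu_\pm}x,\ \overline{e^{is\mu_\pm}y}\bigr),\qquad\text{i.e. } \ell_\pm=\mu_\pm\oplus(-\overline{\mu_\pm}).$$ Let $\mathcal H$ be the symmetric Fock space over $\mathcal H_1$ with zero-particle vector $\Omega_0$, let $\mathcal D\subset\mathcal H$ be the dense span of the vectors $a^*(F_1)\cdots a^*(F_k)\Omega_0$ ($k\ge 0$, $F_i\in\mathcal H_1$), let $\varphi(F)$ be the hermitian field, the closure of $a^*(F)+a(F)$ on $\mathcal D$, and let $e^{isL_\pm}$ be the second quantization of $e^{is\ell_\pm}$. Define $$\varphi_\pm(s,\alpha)=e^{isL_\pm}\varphi(\kappa_\pm(\alpha))e^{-isL_\pm},\qquad \varphi'_\pm(s,\alpha)=e^{isL_\pm}\varphi(\kappa'_\pm(\alpha))e^{-isL_\pm},$$ and, for $0\le t\le\beta/2$, the quantized time-$t$ field $$\widehat{\Phi(t,\alpha)}^{\pm}=\varphi\bigl(e^{-t\ell_\pm}\kappa_\pm(\alpha)\bigr).$$ For a set $S$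 of closed operators let $S'$ be the set of bounded operators $T$ such that $T$ and $T^*$ commute with every $A\in S$ (that is, $TA\subseteq AT$ and $T^*A\subseteq AT^*$), and let $S''$ be the commutant of $S'$. Put $$\mathcal R_0^\pm=\{\varphi_\pm(s,\alpha): s\in\mathbb R,\alpha\in\mathfrak h\}'',\qquad \mathcal R_{\beta/2}^\pm=\{\varphi'_\pm(s,\alpha): s\in\mathbb R,\alpha\in\mathfrak h\}''.$$ Then, for both signs: 1. For all $\alpha,\alpha'\in\mathfrak h$ and $s,s'\in\mathbb R$, $[\varphi_\pm(-s,\bar\alpha),\varphi'_\pm(s',\alpha')]=0$ on $\mathcal D$; both products are defined on $\mathcal D$. (Here $\bar\alpha\in\mathfrak h$ is the complex conjugate of the function $\alpha$.) 2. In particular, for all $\alpha,\alpha'\in\mathfrak h$, $[\widehat{\Phi(0,\alpha)}^{\pm},\widehat{\Phi(\tfrac\beta2,\alpha')}^{\pm}]=0$ on $\mathcal D$; both products are defined on $\mathcal D$. 3. Statements 1 and 2 also hold if each field $\psi(\alpha)$ that occurs in them is replaced by the complex-linear field $\psi(\operatorname{Re}\alpha)+i\,\psi(\operatorname{Im}\alpha)$,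 which agrees with it for real test functions $\alpha$. 4. The algebras $\mathcal R_0^\pm$ and $\mathcal R_{\beta/2}^\pm$ commute: $AB=BA$ for all $A\in\mathcal R_0^\pm$ and $B\in\mathcal R_{\beta/2}^\pm$. -/

import Mathlib

open MeasureTheory Complex
open scoped ENNReal ComplexConjugate InnerProductSpace

noncomputable section

namespace ThermalField

/-! ## The complex conjugate Hilbert space -/

/-- The complex conjugate of a complex Hilbert space `V`: the same additive group and norm, with
the complex structure `-i` and the inner product `⟪x, y⟫ := ⟪y, x⟫_V`. -/
def ConjSpace (V : Type) : Type := V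

namespace ConjSpace

variable {V : Type} [NormedAddCommGroup V] [InnerProductSpace ℂ V]

/-- The canonical conjugate-linear bijection `x ↦ x̄` of `V` onto its conjugate space. -/
def bar (x : V) : ConjSpace V := x

/-- The inverse of `bar`. -/
def unbar (x : ConjSpace V) : V := x

instance : NormedAddCommGroup (ConjSpace V) := inferInstanceAs (NormedAddCommGroup V)

instance : Module ℂ (ConjSpace V) := Module.compHom V (starRingEnd ℂ)

theorem smul_def (c : ℂ) (x : ConjSpace V) : c • x = bar (conj c • unbar x) := rfl

theorem norm_def (x : ConjSpace V) : ‖x‖ = ‖unbar x‖ := rfl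

instance : NormedSpace ℂ (ConjSpace V) where
  norm_smul_le c x := by
    rw [smul_def, norm_def, norm_def x]
    exact (norm_smul_le (conj c) (unbar x)).trans (by simp)

instance : InnerProductSpace ℂ (ConjSpace V) where
  inner x y := ⟪unbar y, unbar x⟫_ℂ
  norm_sq_eq_re_inner x := by
    rw [norm_def]; exact norm_sq_eq_re_inner (𝕜 := ℂ) (unbar x)
  conj_inner_symm x y := inner_conj_symm (𝕜 := ℂ) (unbar y) (unbar x)
  add_left x y z := inner_add_right (𝕜 := ℂ) (unbar z) (unbar x) (unbar y)
  smul_left x y c := inner_smul_right (𝕜 := ℂ) (unbar y) (unbar x) (conj c)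

instance [CompleteSpace V] : CompleteSpace (ConjSpace V) := inferInstanceAs (CompleteSpace V)

end ConjSpace

/-! ## The symmetric Fock space over a Hilbert space -/

section Fock

variable (V : Type) [NormedAddCommGroup V] [InnerProductSpace ℂ V]

/-- Formal finite linear combinations of symmetrised products `a*(F₀) ⋯ a*(Fₙ₋₁) Ω₀` of one-particle
vectors; the product is encoded by the pair `⟨n, F⟩`. -/
abbrev FormalSum (V : Type) : Type := (Σ n : ℕ, Fin n → V) →₀ ℂ

/-- The vector space of formal combinations of products; it carries the pre-inner product below. -/
def PreFock (V : Type) : Type := FormalSum V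

instance (V : Type) : AddCommGroup (PreFock V) := inferInstanceAs (AddCommGroup (FormalSum V))

instance (V : Type) : Module ℂ (PreFock V) := inferInstanceAs (Module ℂ (FormalSum V))

variable {V}

namespace PreFock

/-- The inner product of `a*(F₀) ⋯ a*(Fₙ₋₁) Ω₀` and `a*(G₀) ⋯ a*(Gₘ₋₁) Ω₀`: the permanent
`∑_σ ∏ᵢ ⟪Fᵢ, G_{σ i}⟫`, which is an empty sum, hence `0`, for `n ≠ m`. -/
def kernel (p q : Σ n : ℕ, Fin n → V) : ℂ :=
  ∑ σ : Fin p.1 ≃ Fin q.1, ∏ i, ⟪p.2 i, q.2 (σ i)⟫_ℂ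

/-- The sesquilinear extension of `kernel`. -/
def form (f g : FormalSum V) : ℂ :=
  Finsupp.sum f fun p a => Finsupp.sum g fun q b => conj a * b * kernel p q

theorem kernel_conj (p q : Σ n : ℕ, Fin n → V) : conj (kernel q p) = kernel p q := by
  unfold kernel
  rw [map_sum]
  refine Fintype.sum_equiv ⟨Equiv.symm, Equiv.symm, fun _ => rfl, fun _ => rfl⟩ _ _ fun σ => ?_
  rw [map_prod]
  refine Fintype.prod_equiv σ _ _ fun i => ?_
  simp

theorem form_conj (f g : FormalSum V) : conj (form g f) = form f g := by
  unfold form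
  simp only [Finsupp.sum, map_sum, map_mul, kernel_conj, Complex.conj_conj]
  rw [Finset.sum_comm]
  refine Finset.sum_congr rfl fun p _ => Finset.sum_congr rfl fun q _ => ?_
  ring

theorem form_add_right (f g h : FormalSum V) : form f (g + h) = form f g + form f h := by
  unfold form
  rw [← Finsupp.sum_add]
  refine Finsupp.sum_congr fun p _ => ?_
  exact Finsupp.sum_add_index' (by simp) (by intros; ring)

theorem form_smul_right (c : ℂ) (f g : FormalSum V) : form f (c • g) = c * form f g := by
  unfold form
  rw [Finsupp.mul_sum]
  refine Finsupp.sum_congr fun p _ => ?_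
  rw [Finsupp.mul_sum]
  refine (Finsupp.sum_smul_index' (by simp)).trans (Finsupp.sum_congr fun q _ => ?_)
  simp only [smul_eq_mul]; ring

theorem form_add_left (f g h : FormalSum V) : form (f + g) h = form f h + form g h := by
  rw [← form_conj, form_add_right, map_add, form_conj, form_conj]

theorem form_smul_left (c : ℂ) (f g : FormalSum V) : form (c • f) g = conj c * form f g := by
  rw [← form_conj, form_smul_right, map_mul, form_conj]

/-- Pure tensors can be realised in an inner product space. -/
theorem exists_tensor (V : Type) [NormedAddCommGroup V] [InnerProductSpace ℂ V] (n : ℕ) :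
    ∃ (W : Type) (_ : NormedAddCommGroup W) (_ : InnerProductSpace ℂ W) (u : (Fin n → V) → W),
      ∀ F G, ⟪u F, u G⟫_ℂ = ∏ i, ⟪F i, G i⟫_ℂ := by
  induction n with
  | zero => exact ⟨ℂ, inferInstance, inferInstance, fun _ => 1, by simp⟩
  | succ n ih =>
    obtain ⟨W, i1, i2, u, hu⟩ := ih
    refine ⟨TensorProduct ℂ V W, inferInstance, inferInstance,
      fun F => TensorProduct.tmul ℂ (F 0) (u fun i => F i.succ), fun F G => ?_⟩
    rw [TensorProduct.inner_tmul, hu, Fin.prod_univ_succ]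

/-- Symmetrised tensors can be realised in an inner product space. -/
theorem exists_symTensor (V : Type) [NormedAddCommGroup V] [InnerProductSpace ℂ V] (n : ℕ) :
    ∃ (W : Type) (_ : NormedAddCommGroup W) (_ : InnerProductSpace ℂ W) (u : (Fin n → V) → W),
      ∀ F G : Fin n → V, (n.factorial : ℂ) * kernel ⟨n, F⟩ ⟨n, G⟩ = ⟪u F, u G⟫_ℂ := by
  obtain ⟨W, i1, i2, u, hu⟩ := exists_tensor V n
  refine ⟨W, i1, i2, fun F => ∑ τ : Equiv.Perm (Fin n), u (F ∘ τ), fun F G => ?_⟩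
  rw [sum_inner]
  simp only [inner_sum, hu, Function.comp]
  have key : ∀ τ : Equiv.Perm (Fin n),
      ∑ σ : Equiv.Perm (Fin n), ∏ i, ⟪F (τ i), G (σ i)⟫_ℂ = kernel ⟨n, F⟩ ⟨n, G⟩ := by
    intro τ
    unfold kernel
    refine Fintype.sum_equiv (Equiv.mulRight τ⁻¹) _ _ fun σ => ?_
    refine Fintype.prod_equiv τ _ _ fun i => ?_
    simp
  rw [Finset.sum_congr rfl fun τ _ => key τ]
  simp [Fintype.card_perm]

theorem form_nonneg (f : FormalSum V) : 0 ≤ (form f f).re := by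
  have hform : form f f = ∑ n ∈ Finsupp.splitSupport f,
      (Finsupp.split f n).sum fun F a => (Finsupp.split f n).sum fun G b =>
        conj a * b * kernel ⟨n, F⟩ ⟨n, G⟩ := by
    unfold form
    rw [Finsupp.sigma_sum]
    refine Finset.sum_congr rfl fun n hn => Finsupp.sum_congr fun F _ => ?_
    rw [Finsupp.sigma_sum, Finset.sum_eq_single n]
    · intro m _ hm
      refine Finset.sum_eq_zero fun G _ => ?_
      have : IsEmpty (Fin n ≃ Fin m) :=
        ⟨fun e => hm (by simpa using (Fintype.card_congr e).symm)⟩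
      simp [kernel]
    · exact fun h => absurd hn h
  rw [hform, Complex.re_sum]
  refine Finset.sum_nonneg fun n _ => ?_
  obtain ⟨W, i1, i2, u, hu⟩ := exists_symTensor V n
  set x := Finsupp.split f n
  have hfac : (0 : ℝ) < n.factorial := by exact_mod_cast n.factorial_pos
  have h2 : (n.factorial : ℂ) * (x.sum fun F a => x.sum fun G b =>
      conj a * b * kernel ⟨n, F⟩ ⟨n, G⟩) =
      ⟪x.sum fun F a => a • u F, x.sum fun F a => a • u F⟫_ℂ := by
    simp only [Finsupp.sum, sum_inner, inner_smul_left, Finset.mul_sum]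
    refine Finset.sum_congr rfl fun F _ => ?_
    simp only [inner_sum, inner_smul_right, ← hu, Finset.mul_sum]
    refine Finset.sum_congr rfl fun G _ => ?_
    ring
  have h3 := congrArg Complex.re h2
  have h4 : 0 ≤ (⟪x.sum fun F a => a • u F, x.sum fun F a => a • u F⟫_ℂ).re :=
    inner_self_nonneg (𝕜 := ℂ)
  rw [← h3, ← Complex.ofReal_natCast, Complex.re_ofReal_mul] at h4
  exact nonneg_of_mul_nonneg_right h4 hfac

end PreFock

/-- The pre-inner product of `PreFock V`. -/
abbrev preFockCore : PreInnerProductSpace.Core ℂ (PreFock V) where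
  inner := PreFock.form
  conj_inner_symm := fun f g => PreFock.form_conj f g
  re_inner_nonneg := fun f => PreFock.form_nonneg f
  add_left := PreFock.form_add_left
  smul_left := fun f g c => PreFock.form_smul_left c f g

instance : SeminormedAddCommGroup (PreFock V) :=
  InnerProductSpace.Core.toSeminormedAddCommGroup (c := preFockCore)

instance : InnerProductSpace ℂ (PreFock V) := InnerProductSpace.ofCore preFockCore

theorem PreFock.inner_def (f g : PreFock V) : ⟪f, g⟫_ℂ = PreFock.form f g := rfl

variable (V) in
/-- The symmetric (bosonic) Fock space `ℂ ⊕ V ⊕ (V ⊗ₛ V) ⊕ ⋯` over `V`: the Hilbert space completion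
of the span of the symmetrised product vectors. -/
abbrev Fock : Type := UniformSpace.Completion (PreFock V)

/-- The class in the Fock space of a formal combination of product vectors. -/
def PreFock.toFock : PreFock V →ₗ[ℂ] Fock V :=
  (UniformSpace.Completion.toComplₗᵢ (𝕜 := ℂ) (E := PreFock V)).toLinearMap

variable (V) in
/-- The dense subspace of the Fock space spanned by the product vectors
`a*(F₀) ⋯ a*(Fₙ₋₁) Ω₀`, `n ≥ 0`. -/
def finiteVectors : Submodule ℂ (Fock V) := LinearMap.range (PreFock.toFock (V := V))

/-- The product vector `a*(F₀) ⋯ a*(Fₙ₋₁) Ω₀`; for `n = 0` this is the zero-particle vector. -/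
def PreFock.prodVec (n : ℕ) (F : Fin n → V) : PreFock V := Finsupp.single ⟨n, F⟩ 1

/-- `a*(F)` on products: `a*(G₀) ⋯ a*(Gₙ₋₁) Ω₀ ↦ a*(F) a*(G₀) ⋯ a*(Gₙ₋₁) Ω₀`. -/
def PreFock.creation (F : V) : PreFock V →ₗ[ℂ] PreFock V :=
  Finsupp.linearCombination ℂ fun q : Σ n : ℕ, Fin n → V =>
    PreFock.prodVec (q.1 + 1) (Fin.cons F q.2)

/-- The annihilation operator on a product vector:
`a*(G₀) ⋯ a*(Gₙ₋₁) Ω₀ ↦ ∑ⱼ ⟪F, Gⱼ⟫ ∏_{i ≠ j} a*(Gᵢ) Ω₀`. -/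
def PreFock.annihilationProd (F : V) : (Σ n : ℕ, Fin n → V) → PreFock V
  | ⟨0, _⟩ => 0
  | ⟨n + 1, G⟩ => ∑ j : Fin (n + 1), ⟪F, G j⟫_ℂ • PreFock.prodVec n fun i => G (j.succAbove i)

/-- `a(F)` on combinations of product vectors. -/
def PreFock.annihilation (F : V) : PreFock V →ₗ[ℂ] PreFock V :=
  Finsupp.linearCombination ℂ (PreFock.annihilationProd F)

/-- The hermitian field `a*(F) + a(F)` on combinations of product vectors. -/
def PreFock.field (F : V) : PreFock V →ₗ[ℂ] PreFock V :=
  PreFock.creation F + PreFock.annihilation F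

namespace PreFock

theorem inner_prodVec (n m : ℕ) (F : Fin n → V) (G : Fin m → V) :
    ⟪prodVec n F, prodVec m G⟫_ℂ = kernel ⟨n, F⟩ ⟨m, G⟩ := by
  rw [inner_def, prodVec, prodVec]
  unfold form
  refine (Finsupp.sum_single_index (by simp)).trans ((Finsupp.sum_single_index (by simp)).trans ?_)
  simp

/-- Expansion of the permanent along the first factor. -/
theorem kernel_cons (F : V) (n m : ℕ) (p : Fin n → V) (q : Fin (m + 1) → V) :
    kernel ⟨n + 1, Fin.cons F p⟩ ⟨m + 1, q⟩ =
      ∑ j : Fin (m + 1), ⟪F, q j⟫_ℂ * kernel ⟨n, p⟩ ⟨m, fun i => q (j.succAbove i)⟩ := by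
  let Φ : Fin (m + 1) × (Fin n ≃ Fin m) → (Fin (n + 1) ≃ Fin (m + 1)) := fun x =>
    ((finSuccEquiv' 0).trans x.2.optionCongr).trans (finSuccEquiv' x.1).symm
  have h0 : ∀ x, Φ x 0 = x.1 := fun x => by simp [Φ]
  have hs : ∀ x i, Φ x (Fin.succ i) = x.1.succAbove (x.2 i) := fun x i => by
    have : finSuccEquiv' (0 : Fin (n + 1)) i.succ = some i := by
      simp
    simp [Φ, this]
  have hΦ : Function.Bijective Φ := by
    constructor
    · rintro ⟨j, e⟩ ⟨j', e'⟩ h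
      have hj : j = j' := (h0 (j, e)).symm.trans ((congrArg (fun σ => σ 0) h).trans (h0 (j', e')))
      subst hj
      congr 1
      ext1 i
      have := DFunLike.congr_fun h i.succ
      rw [hs, hs] at this
      exact Fin.succAbove_right_injective this
    · intro σ
      let τ := ((finSuccEquiv' (0 : Fin (n + 1))).symm.trans σ).trans (finSuccEquiv' (σ 0))
      have hτ : τ none = none := by simp [τ]
      refine ⟨(σ 0, τ.removeNone), ?_⟩
      ext1 i
      refine Fin.cases ?_ (fun i => ?_) i
      · rw [h0]
      · rw [hs]
        have hne : τ (some i) ≠ none := fun h => by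
          have := τ.injective (h.trans hτ.symm)
          simp at this
        have h1 : some (τ.removeNone i) = τ (some i) :=
          Equiv.removeNone_some τ (Option.ne_none_iff_exists'.1 hne)
        have h2 : τ (some i) = finSuccEquiv' (σ 0) (σ i.succ) := by simp [τ]
        have h3 := congrArg (finSuccEquiv' (σ 0)).symm (h1.trans h2)
        simpa using h3
  unfold kernel
  rw [← Fintype.sum_bijective Φ hΦ _ _ fun _ => rfl, Fintype.sum_prod_type]
  refine Finset.sum_congr rfl fun j _ => ?_
  rw [Finset.mul_sum]
  refine Finset.sum_congr rfl fun e _ => ?_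
  simp only [Fin.prod_univ_succ]
  simp [h0, hs]

theorem creation_prodVec (F : V) (n : ℕ) (p : Fin n → V) :
    creation F (prodVec n p) = prodVec (n + 1) (Fin.cons F p) := by
  unfold creation
  rw [prodVec]
  exact (Finsupp.linearCombination_single ℂ _ _).trans (one_smul _ _)

theorem annihilation_prodVec (F : V) (n : ℕ) (q : Fin n → V) :
    annihilation F (prodVec n q) = annihilationProd F ⟨n, q⟩ := by
  unfold annihilation
  rw [prodVec]
  exact (Finsupp.linearCombination_single ℂ _ _).trans (one_smul _ _)

theorem inner_creation_prodVec (F : V) (p q : Σ n : ℕ, Fin n → V) :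
    ⟪creation F (prodVec p.1 p.2), prodVec q.1 q.2⟫_ℂ =
      ⟪prodVec p.1 p.2, annihilation F (prodVec q.1 q.2)⟫_ℂ := by
  obtain ⟨n, p⟩ := p
  obtain ⟨m, q⟩ := q
  simp only [creation_prodVec, annihilation_prodVec, inner_prodVec]
  cases m with
  | zero =>
    have : IsEmpty (Fin (n + 1) ≃ Fin 0) := ⟨fun e => (e 0).elim0⟩
    simp [kernel, annihilationProd]
  | succ m =>
    rw [kernel_cons, annihilationProd, inner_sum]
    simp only [inner_smul_right, inner_prodVec]

theorem induction_prodVec {P : PreFock V → Prop} (f : PreFock V) (h0 : P 0)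
    (hadd : ∀ f g, P f → P g → P (f + g)) (hsmul : ∀ (c : ℂ) f, P f → P (c • f))
    (hv : ∀ q : Σ n : ℕ, Fin n → V, P (prodVec q.1 q.2)) : P f := by
  refine Finsupp.induction_linear (motive := P) f h0 hadd fun q c => ?_
  have : (Finsupp.single q c : PreFock V) = c • prodVec q.1 q.2 := by
    unfold prodVec
    exact ((Finsupp.smul_single c q (1 : ℂ)).trans (by simp)).symm
  rw [this]
  exact hsmul _ _ (hv q)

/-- `a(F)` is the formal adjoint of `a*(F)`. -/
theorem inner_creation (F : V) (f g : PreFock V) :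
    ⟪creation F f, g⟫_ℂ = ⟪f, annihilation F g⟫_ℂ := by
  refine induction_prodVec (P := fun f => ⟪creation F f, g⟫_ℂ = ⟪f, annihilation F g⟫_ℂ) f ?_
    (fun f f' h h' => ?_) (fun c f h => ?_) fun p => ?_
  · simp only [map_zero, inner_zero_left]
  · simp only [map_add, inner_add_left, h, h']
  · simp only [map_smul, inner_smul_left, h]
  · refine induction_prodVec (P := fun g => ⟪creation F (prodVec p.1 p.2), g⟫_ℂ =
      ⟪prodVec p.1 p.2, annihilation F g⟫_ℂ) g ?_ (fun f f' h h' => ?_) (fun c f h => ?_) fun q => ?_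
    · simp only [map_zero, inner_zero_right]
    · simp only [map_add, inner_add_right, h, h']
    · simp only [map_smul, inner_smul_right, h]
    · exact inner_creation_prodVec F p q

/-- The field is symmetric. -/
theorem inner_field (F : V) (f g : PreFock V) : ⟪field F f, g⟫_ℂ = ⟪f, field F g⟫_ℂ := by
  have h : ⟪annihilation F f, g⟫_ℂ = ⟪f, creation F g⟫_ℂ := by
    rw [← inner_conj_symm, ← inner_creation, inner_conj_symm]
  simp only [field, LinearMap.add_apply, inner_add_left, inner_add_right, inner_creation, h]
  ring

end PreFock

/-- The graph of the field `a*(F) + a(F)` on the span of the product vectors. -/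
def fieldGraph (F : V) : Submodule ℂ (Fock V × Fock V) :=
  LinearMap.range ((PreFock.toFock (V := V)).prod (PreFock.toFock ∘ₗ PreFock.field F))

/-- The field is well defined on vectors of the Fock space. -/
theorem fieldGraph_single_valued (F : V) :
    ∀ x ∈ fieldGraph F, x.1 = 0 → x.2 = 0 := by
  rintro x ⟨f, rfl⟩ h
  change (PreFock.toFock f : Fock V) = 0 at h
  change (PreFock.toFock (PreFock.field F f) : Fock V) = 0
  have h1 : ‖f‖ = 0 := by
    rw [← UniformSpace.Completion.norm_coe f]
    exact norm_eq_zero.2 h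
  have h2 : ‖PreFock.field F f‖ = 0 := by
    have h3 : ⟪PreFock.field F f, PreFock.field F f⟫_ℂ = 0 := by
      rw [PreFock.inner_field]
      refine norm_eq_zero.1 (le_antisymm ?_ (norm_nonneg _))
      exact (norm_inner_le_norm _ _).trans (by rw [h1, zero_mul])
    have h4 := inner_self_eq_norm_sq (𝕜 := ℂ) (PreFock.field F f)
    rw [h3] at h4
    simpa using h4.symm
  refine norm_eq_zero.1 ?_
  rw [← h2]
  exact UniformSpace.Completion.norm_coe _

/-- The field `a*(F) + a(F)` as an operator with domain `finiteVectors V`. -/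
def fieldOnFinite (F : V) : Fock V →ₗ.[ℂ] Fock V := (fieldGraph F).toLinearPMap

/-- The hermitian field `φ(F)`: the closure of `a*(F) + a(F)` on the span of the product vectors. -/
def fieldOp (F : V) : Fock V →ₗ.[ℂ] Fock V := (fieldOnFinite F).closure

theorem fieldOnFinite_domain (F : V) : (fieldOnFinite F).domain = finiteVectors V := by
  unfold fieldOnFinite fieldGraph finiteVectors
  rw [Submodule.toLinearPMap_domain]
  ext x
  simp

theorem fieldOnFinite_apply (F : V) (f : PreFock V) (x : (fieldOnFinite F).domain)
    (hx : (x : Fock V) = PreFock.toFock f) :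
    fieldOnFinite F x = PreFock.toFock (PreFock.field F f) := by
  have h1 := Submodule.mem_graph_toLinearPMap (fieldGraph_single_valued F) x
  have h2 : (PreFock.toFock f, PreFock.toFock (PreFock.field F f)) ∈ fieldGraph F := ⟨f, rfl⟩
  have h3 := fieldGraph_single_valued F _ (Submodule.sub_mem _ h1 h2) (by simp [hx])
  exact sub_eq_zero.1 h3

theorem finiteVectors_dense : Dense (finiteVectors V : Set (Fock V)) := by
  have := UniformSpace.Completion.denseRange_coe (α := PreFock V)
  exact this

/-- `a*(F) + a(F)` is closable, so `fieldOp F` is a closed operator. -/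
theorem fieldOnFinite_isClosable (F : V) : (fieldOnFinite F).IsClosable := by
  have hd : Dense ((fieldOnFinite F).domain : Set (Fock V)) := by
    rw [fieldOnFinite_domain]; exact finiteVectors_dense
  have hsym : (fieldOnFinite F).IsFormalAdjoint (fieldOnFinite F) := by
    rintro ⟨x, hx⟩ ⟨y, hy⟩
    obtain ⟨f, hf⟩ : x ∈ finiteVectors V := by rwa [← fieldOnFinite_domain F]
    obtain ⟨g, hg⟩ : y ∈ finiteVectors V := by rwa [← fieldOnFinite_domain F]
    rw [fieldOnFinite_apply F f _ hf.symm, fieldOnFinite_apply F g _ hg.symm]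
    simp only [← hf, ← hg]
    have h := PreFock.inner_field F f g
    exact (UniformSpace.Completion.inner_coe _ _).trans
      (h.trans (UniformSpace.Completion.inner_coe _ _).symm)
  exact (LinearPMap.adjoint_isClosed hd).isClosable.leIsClosable (hsym.le_adjoint hd)

/-- Second quantization on formal combinations of product vectors. -/
def PreFock.map (U : V →ₗᵢ[ℂ] V) : PreFock V →ₗ[ℂ] PreFock V :=
  Finsupp.linearCombination ℂ fun q : Σ n : ℕ, Fin n → V =>
    PreFock.prodVec q.1 fun i => U (q.2 i)

theorem PreFock.map_prodVec (U : V →ₗᵢ[ℂ] V) (n : ℕ) (q : Fin n → V) :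
    PreFock.map U (prodVec n q) = prodVec n fun i => U (q i) := by
  unfold PreFock.map
  rw [prodVec]
  exact (Finsupp.linearCombination_single ℂ _ _).trans (one_smul _ _)

theorem PreFock.inner_map (U : V →ₗᵢ[ℂ] V) (f g : PreFock V) :
    ⟪PreFock.map U f, PreFock.map U g⟫_ℂ = ⟪f, g⟫_ℂ := by
  refine induction_prodVec (P := fun f => ⟪PreFock.map U f, PreFock.map U g⟫_ℂ = ⟪f, g⟫_ℂ) f ?_
    (fun f f' h h' => ?_) (fun c f h => ?_) fun p => ?_
  · simp only [map_zero, inner_zero_left]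
  · simp only [map_add, inner_add_left, h, h']
  · simp only [map_smul, inner_smul_left, h]
  · refine induction_prodVec (P := fun g => ⟪PreFock.map U (prodVec p.1 p.2), PreFock.map U g⟫_ℂ =
      ⟪prodVec p.1 p.2, g⟫_ℂ) g ?_ (fun f f' h h' => ?_) (fun c f h => ?_) fun q => ?_
    · simp only [map_zero, inner_zero_right]
    · simp only [map_add, inner_add_right, h, h']
    · simp only [map_smul, inner_smul_right, h]
    · rw [map_prodVec, map_prodVec, inner_prodVec, inner_prodVec]
      simp [kernel]

/-- The second quantization `Γ(U)` of a one-particle isometry `U`, i.e. `1` on `ℂ` and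
`U ⊗ ⋯ ⊗ U` on the `n`-particle space. -/
def secondQuantization (U : V →ₗᵢ[ℂ] V) : Fock V →L[ℂ] Fock V :=
  ((PreFock.map U).mkContinuous 1 fun f => by
    have h := PreFock.inner_map U f f
    have h1 := norm_sq_eq_re_inner (𝕜 := ℂ) (PreFock.map U f)
    rw [h, ← norm_sq_eq_re_inner] at h1
    rw [one_mul]
    exact ((sq_eq_sq₀ (norm_nonneg _) (norm_nonneg _)).1 h1).le).completion

end Fock

/-! ## Unbounded operators, commutators and von Neumann algebras -/

section Operators

variable {H : Type} [NormedAddCommGroup H] [InnerProductSpace ℂ H]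

/-- The operator `W A W'` with domain `{x | W' x ∈ D(A)}`. -/
def sandwich (W : H →L[ℂ] H) (A : H →ₗ.[ℂ] H) (W' : H →L[ℂ] H) : H →ₗ.[ℂ] H where
  domain := A.domain.comap W'.toLinearMap
  toFun := W.toLinearMap ∘ₗ A.toFun ∘ₗ
    (W'.toLinearMap.restrict (p := A.domain.comap W'.toLinearMap) (q := A.domain) fun _ hx => hx)

/-- `[A, B] = 0` on the subspace `D`: `AB` and `BA` are defined and equal on `D`. -/
def CommuteOn (D : Submodule ℂ H) (A B : H →ₗ.[ℂ] H) : Prop :=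
  ∀ x ∈ D, ∃ (hA : x ∈ A.domain) (hB : x ∈ B.domain)
    (hAB : B ⟨x, hB⟩ ∈ A.domain) (hBA : A ⟨x, hA⟩ ∈ B.domain),
    A ⟨B ⟨x, hB⟩, hAB⟩ = B ⟨A ⟨x, hA⟩, hBA⟩

/-- The bounded operator `T` commutes with the unbounded operator `A`, i.e. `T A ⊆ A T`. -/
def BoundedCommutes (T : H →L[ℂ] H) (A : H →ₗ.[ℂ] H) : Prop :=
  ∀ x : A.domain, ∃ h : T x ∈ A.domain, A ⟨T x, h⟩ = T (A x)

variable [CompleteSpace H]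

/-- The commutant `S'` of a set of closed operators: the bounded operators `T` such that `T` and
`T*` commute with all members of `S`. -/
def commutant (S : Set (H →ₗ.[ℂ] H)) : Set (H →L[ℂ] H) :=
  {T | ∀ A ∈ S, BoundedCommutes T A ∧ BoundedCommutes (ContinuousLinearMap.adjoint T) A}

/-- The von Neumann algebra `S''` generated by (the bounded functions of) a set `S` of closed
operators. -/
def generatedAlgebra (S : Set (H →ₗ.[ℂ] H)) : Set (H →L[ℂ] H) :=
  Set.centralizer (commutant S)

end Operators

/-! ## The one-particle space and the thermal fields -/

/-- The momentum space `ℝⁿ`, `n = d - 1`. -/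
abbrev Momentum (n : ℕ) : Type := EuclideanSpace ℝ (Fin n)

/-- The parameters: mass `m > 0`, inverse temperature `β > 0`, velocity `|v| < 1`. -/
structure Params (n : ℕ) where
  m : ℝ
  β : ℝ
  v : Momentum n
  m_pos : 0 < m
  β_pos : 0 < β
  v_lt : ‖v‖ < 1

namespace Params

variable {n : ℕ} (P : Params n)

/-- `μ(k) = (k² + m²)^{1/2}`. -/
def μ (k : Momentum n) : ℝ := Real.sqrt (‖k‖ ^ 2 + P.m ^ 2)

/-- `μ_±(k) = μ(k) ± k · v`; the sign is `ε`. -/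
def μs (ε : ℤˣ) (k : Momentum n) : ℝ := P.μ k + ((ε : ℤ) : ℝ) * ⟪k, P.v⟫_ℝ

/-- `ρ_± = e^{-β μ_±} / (1 - e^{-β μ_±})`. -/
def ρ (ε : ℤˣ) (k : Momentum n) : ℝ :=
  Real.exp (-P.β * P.μs ε k) / (1 - Real.exp (-P.β * P.μs ε k))

theorem m_le_μ (k : Momentum n) : P.m ≤ P.μ k :=
  Real.le_sqrt_of_sq_le (by nlinarith [sq_nonneg ‖k‖])

theorem norm_le_μ (k : Momentum n) : ‖k‖ ≤ P.μ k :=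
  Real.le_sqrt_of_sq_le (by nlinarith [sq_nonneg P.m])

theorem μ_neg (k : Momentum n) : P.μ (-k) = P.μ k := by simp [μ]

theorem continuous_μ : Continuous P.μ := by unfold μ; fun_prop

theorem continuous_μs (ε : ℤˣ) : Continuous (P.μs ε) := by
  unfold μs
  have := P.continuous_μ
  fun_prop

/-- A positive lower bound of `μ_±`. -/
def gap : ℝ := (1 - ‖P.v‖) * P.m

theorem gap_pos : 0 < P.gap := mul_pos (by linarith [P.v_lt]) P.m_pos

theorem gap_le (ε : ℤˣ) (k : Momentum n) : P.gap ≤ P.μs ε k := by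
  have h1 := abs_le.1 (abs_real_inner_le_norm k P.v)
  have h2 := P.norm_le_μ k
  have h3 := P.m_le_μ k
  have h4 : ‖k‖ * ‖P.v‖ ≤ P.μ k * ‖P.v‖ := mul_le_mul_of_nonneg_right h2 (norm_nonneg _)
  have h5 : (1 - ‖P.v‖) * P.m ≤ (1 - ‖P.v‖) * P.μ k :=
    mul_le_mul_of_nonneg_left h3 (by linarith [P.v_lt])
  unfold gap μs
  rcases Int.units_eq_one_or ε with rfl | rfl
  · simp; linarith [h1.1]
  · simp; linarith [h1.2]

theorem exp_lt_one (ε : ℤˣ) (k : Momentum n) : Real.exp (-P.β * P.μs ε k) < 1 :=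
  Real.exp_lt_one_iff.2 (by nlinarith [P.β_pos, P.gap_pos, P.gap_le ε k])

theorem one_add_ρ (ε : ℤˣ) (k : Momentum n) :
    1 + P.ρ ε k = (1 - Real.exp (-P.β * P.μs ε k))⁻¹ := by
  have := P.exp_lt_one ε k
  have h : 1 - Real.exp (-P.β * P.μs ε k) ≠ 0 := by linarith
  unfold ρ
  rw [one_add_div h, sub_add_cancel, one_div]

theorem ρ_nonneg (ε : ℤˣ) (k : Momentum n) : 0 ≤ P.ρ ε k :=
  div_nonneg (Real.exp_nonneg _) (by linarith [P.exp_lt_one ε k])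

/-- An upper bound of `1 + ρ_±`. -/
def bound : ℝ := (1 - Real.exp (-P.β * P.gap))⁻¹

theorem one_add_ρ_le (ε : ℤˣ) (k : Momentum n) : 1 + P.ρ ε k ≤ P.bound := by
  rw [one_add_ρ, bound]
  have h1 : Real.exp (-P.β * P.μs ε k) ≤ Real.exp (-P.β * P.gap) :=
    Real.exp_le_exp.2 (by nlinarith [P.β_pos, P.gap_le ε k])
  have h2 : Real.exp (-P.β * P.gap) < 1 :=
    Real.exp_lt_one_iff.2 (by nlinarith [P.β_pos, P.gap_pos])
  exact inv_anti₀ (by linarith) (by linarith)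

theorem measurable_ρ (ε : ℤˣ) : Measurable (P.ρ ε) := by
  have := (P.continuous_μs ε).measurable
  unfold ρ
  fun_prop

/-- The measure `dk / (2 μ(k))`. -/
def ν : Measure (Momentum n) :=
  volume.withDensity fun k => ENNReal.ofReal (1 / (2 * P.μ k))

/-- The Sobolev space `𝔥 = 𝔥_{-1/2}(ℝⁿ)` with inner product
`⟪α, α'⟫ = ⟪(2μ)^{-1/2} α, (2μ)^{-1/2} α'⟫_{L²}`; its elements are represented by their (unitary)
Fourier transforms `α̃(k)`, so that functions of the momentum are multiplication operators. -/
abbrev 𝔥 : Type := Lp ℂ 2 P.ν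

theorem measurePreserving_neg : MeasurePreserving (fun k : Momentum n => -k) P.ν P.ν := by
  refine ⟨measurable_neg, ?_⟩
  have hv : MeasurePreserving (fun k : Momentum n => -k) volume volume :=
    Measure.measurePreserving_neg volume
  ext s hs
  rw [Measure.map_apply measurable_neg hs]
  unfold ν
  rw [withDensity_apply _ (measurable_neg hs), withDensity_apply _ hs,
    ← hv.setLIntegral_comp_preimage hs (by
      have := P.continuous_μ.measurable
      fun_prop)]
  simp [μ_neg]

/-- Complex conjugation `α ↦ ᾱ` in position space: the Fourier transform of `ᾱ` is
`k ↦ conj (α̃(-k))`. -/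
def conjugate (α : P.𝔥) : P.𝔥 :=
  (((Lp.memLp α).comp_measurePreserving P.measurePreserving_neg).star).toLp
    (star (α ∘ fun k => -k))

/-- The real part `(α + ᾱ) / 2` of `α` in position space. -/
def rePart (α : P.𝔥) : P.𝔥 := (2 : ℂ)⁻¹ • (α + P.conjugate α)

/-- The imaginary part `(α - ᾱ) / (2 i)` of `α` in position space. -/
def imPart (α : P.𝔥) : P.𝔥 := (2 * I)⁻¹ • (α - P.conjugate α)

theorem memLp_mul {σ : Momentum n → ℂ} (hσ : Measurable σ) (hb : ∃ C, ∀ k, ‖σ k‖ ≤ C)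
    (α : P.𝔥) : MemLp (fun k => σ k * α k) 2 P.ν := by
  obtain ⟨C, hC⟩ := hb
  refine (Lp.memLp α).of_le_mul (c := C)
    (hσ.aestronglyMeasurable.mul (Lp.memLp α).aestronglyMeasurable) ?_
  refine Filter.Eventually.of_forall fun k => ?_
  rw [norm_mul]
  exact mul_le_mul_of_nonneg_right (hC k) (norm_nonneg _)

/-- Multiplication in Fourier space by a bounded measurable function. -/
def mulOp (σ : Momentum n → ℂ) (hσ : Measurable σ) (hb : ∃ C, ∀ k, ‖σ k‖ ≤ C) :
    P.𝔥 →ₗ[ℂ] P.𝔥 where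
  toFun α := (P.memLp_mul hσ hb α).toLp (fun k => σ k * α k)
  map_add' α α' := by
    rw [← MemLp.toLp_add, MemLp.toLp_eq_toLp_iff]
    filter_upwards [Lp.coeFn_add α α'] with k hk
    simp only [Pi.add_apply] at hk ⊢
    rw [hk, mul_add]
  map_smul' c α := by
    rw [RingHom.id_apply, ← MemLp.toLp_const_smul, MemLp.toLp_eq_toLp_iff]
    filter_upwards [Lp.coeFn_smul c α] with k hk
    simp only [Pi.smul_apply, smul_eq_mul] at hk ⊢
    rw [hk]
    ring

/-- The unitary `e^{i s μ_±}` on `𝔥`. -/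
def evolve (ε : ℤˣ) (s : ℝ) : P.𝔥 →ₗᵢ[ℂ] P.𝔥 where
  toLinearMap := P.mulOp (fun k => cexp (I * ((s * P.μs ε k : ℝ) : ℂ)))
    (by have := (P.continuous_μs ε).measurable; fun_prop)
    ⟨1, fun k => by rw [mul_comm, Complex.norm_exp_ofReal_mul_I]⟩
  norm_map' α := by
    simp only [mulOp, LinearMap.coe_mk, AddHom.coe_mk]
    rw [Lp.norm_toLp, Lp.norm_def]
    congr 1
    refine eLpNorm_congr_norm_ae (Filter.Eventually.of_forall fun k => ?_)
    rw [norm_mul, mul_comm I, Complex.norm_exp_ofReal_mul_I, one_mul]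

/-- The operator `e^{-t μ_±} (1 + ρ_±)^{1/2}` on `𝔥` for `t ≥ 0`. -/
def factorA (ε : ℤˣ) (t : ℝ) (ht : 0 ≤ t) : P.𝔥 →ₗ[ℂ] P.𝔥 :=
  P.mulOp (fun k => ((Real.exp (-t * P.μs ε k) * Real.sqrt (1 + P.ρ ε k) : ℝ) : ℂ))
    (by have := (P.continuous_μs ε).measurable; have := P.measurable_ρ ε; fun_prop)
    ⟨Real.sqrt P.bound, fun k => by
      rw [Complex.norm_real, Real.norm_of_nonneg (by positivity)]
      have h1 : Real.exp (-t * P.μs ε k) ≤ 1 :=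
        Real.exp_le_one_iff.2 (by nlinarith [P.gap_pos, P.gap_le ε k])
      have h2 := Real.sqrt_le_sqrt (P.one_add_ρ_le ε k)
      nlinarith [Real.sqrt_nonneg (1 + P.ρ ε k)]⟩

/-- The operator `e^{t μ_±} ρ_±^{1/2}` on `𝔥` for `t ≤ β / 2`. -/
def factorB (ε : ℤˣ) (t : ℝ) (ht : t ≤ P.β / 2) : P.𝔥 →ₗ[ℂ] P.𝔥 :=
  P.mulOp (fun k => ((Real.exp (t * P.μs ε k) * Real.sqrt (P.ρ ε k) : ℝ) : ℂ))
    (by have := (P.continuous_μs ε).measurable; have := P.measurable_ρ ε; fun_prop)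
    ⟨Real.sqrt P.bound, fun k => by
      rw [Complex.norm_real, Real.norm_of_nonneg (by positivity)]
      have hμ : 0 < P.μs ε k := P.gap_pos.trans_le (P.gap_le ε k)
      refine le_trans ?_ (Real.sqrt_le_sqrt (P.one_add_ρ_le ε k))
      refine Real.le_sqrt_of_sq_le ?_
      rw [mul_pow, Real.sq_sqrt (P.ρ_nonneg ε k), ← Real.exp_nat_mul, one_add_ρ, ρ, ← mul_div_assoc,
        ← Real.exp_add, div_eq_mul_inv]
      have h0 : 0 ≤ (1 - Real.exp (-P.β * P.μs ε k))⁻¹ :=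
        inv_nonneg.2 (by linarith [P.exp_lt_one ε k])
      refine mul_le_of_le_one_left h0 (Real.exp_le_one_iff.2 ?_)
      push_cast
      nlinarith⟩

/-- The one-particle space `𝓗₁ = 𝔥 ⊕ 𝔥̄` of the thermal representation. -/
abbrev H₁ : Type := WithLp 2 (P.𝔥 × ConjSpace P.𝔥)

/-- `(x, ȳ) ∈ 𝓗₁`. -/
def pair (x y : P.𝔥) : P.H₁ := WithLp.toLp 2 (x, ConjSpace.bar y)

/-- The sharp-time vector `e^{-t ℓ_±} κ_±(α)`, the quantization of `δ_t ⊗ α` for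
`0 ≤ t ≤ β / 2`. -/
def sharpTime (ε : ℤˣ) (t : ℝ) (h0 : 0 ≤ t) (h1 : t ≤ P.β / 2) (α : P.𝔥) : P.H₁ :=
  P.pair (P.factorA ε t h0 α) (P.factorB ε t h1 α)

theorem half_β_nonneg : 0 ≤ P.β / 2 := by linarith [P.β_pos]

/-- `(1 + ρ_±)^{1/2}` on `𝔥`. -/
def sqrtOneAddρ (ε : ℤˣ) : P.𝔥 →ₗ[ℂ] P.𝔥 :=
  P.mulOp (fun k => (Real.sqrt (1 + P.ρ ε k) : ℂ))
    (by have := P.measurable_ρ ε; fun_prop)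
    ⟨Real.sqrt P.bound, fun k => by
      rw [Complex.norm_real, Real.norm_of_nonneg (by positivity)]
      exact Real.sqrt_le_sqrt (P.one_add_ρ_le ε k)⟩

/-- `ρ_±^{1/2}` on `𝔥`. -/
def sqrtρ (ε : ℤˣ) : P.𝔥 →ₗ[ℂ] P.𝔥 :=
  P.mulOp (fun k => (Real.sqrt (P.ρ ε k) : ℂ))
    (by have := P.measurable_ρ ε; fun_prop)
    ⟨Real.sqrt P.bound, fun k => by
      rw [Complex.norm_real, Real.norm_of_nonneg (by positivity)]
      exact Real.sqrt_le_sqrt (by linarith [P.one_add_ρ_le ε k])⟩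

/-- The Araki-Woods map `κ_±(α) = ((1 + ρ_±)^{1/2} α, bar (ρ_±^{1/2} α))`. -/
def κ (ε : ℤˣ) (α : P.𝔥) : P.H₁ := P.pair (P.sqrtOneAddρ ε α) (P.sqrtρ ε α)

/-- The map `κ'_±(α) = (ρ_±^{1/2} α, bar ((1 + ρ_±)^{1/2} α))`. -/
def κ' (ε : ℤˣ) (α : P.𝔥) : P.H₁ := P.pair (P.sqrtρ ε α) (P.sqrtOneAddρ ε α)

/-- The one-particle unitary group `e^{i s ℓ_±}`, `(x, ȳ) ↦ (e^{i s μ_±} x, bar (e^{i s μ_±} y))`.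
As the complex structure of the second summand is `-i`, its generator `ℓ_±` is `μ_±` on the first
summand and minus the conjugate of `μ_±`, which is `-μ_∓` in position space, on the second. -/
def evolve₁ (ε : ℤˣ) (s : ℝ) : P.H₁ →ₗᵢ[ℂ] P.H₁ where
  toFun x := P.pair (P.evolve ε s x.fst) (P.evolve ε s (ConjSpace.unbar x.snd))
  map_add' x y := by
    simp only [WithLp.add_fst, WithLp.add_snd, map_add]
    have : P.evolve ε s (ConjSpace.unbar (x.snd + y.snd)) =
        P.evolve ε s (ConjSpace.unbar x.snd) + P.evolve ε s (ConjSpace.unbar y.snd) :=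
      map_add (P.evolve ε s) _ _
    rw [this]
    rfl
  map_smul' c x := by
    simp only [WithLp.smul_fst, WithLp.smul_snd, map_smul, RingHom.id_apply]
    have : P.evolve ε s (ConjSpace.unbar (c • x.snd)) =
        conj c • P.evolve ε s (ConjSpace.unbar x.snd) :=
      map_smul (P.evolve ε s) (conj c) _
    rw [this]
    rfl
  norm_map' x := by
    simp only [LinearMap.coe_mk, AddHom.coe_mk]
    rw [WithLp.prod_norm_eq_of_L2, WithLp.prod_norm_eq_of_L2]
    have h1 : ‖(P.pair (P.evolve ε s x.fst) (P.evolve ε s (ConjSpace.unbar x.snd))).fst‖ =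
        ‖x.fst‖ := (P.evolve ε s).norm_map _
    have h2 : ‖(P.pair (P.evolve ε s x.fst) (P.evolve ε s (ConjSpace.unbar x.snd))).snd‖ =
        ‖x.snd‖ := (P.evolve ε s).norm_map (ConjSpace.unbar x.snd)
    rw [h1, h2]

/-- The Fock space `𝓗` over `𝓗₁`. -/
abbrev 𝓗 : Type := Fock P.H₁

/-- The unitary `e^{i s L_±} = Γ(e^{i s ℓ_±})` on the Fock space; its generator is the Liouvillean
`L_±`, the second quantization of `ℓ_±`. -/
def expL (ε : ℤˣ) (s : ℝ) : P.𝓗 →L[ℂ] P.𝓗 := secondQuantization (P.evolve₁ ε s)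

/-- The thermal field `φ_±(s, α) = e^{i s L_±} φ(κ_±(α)) e^{-i s L_±}`. -/
def thermalField (ε : ℤˣ) (s : ℝ) (α : P.𝔥) : P.𝓗 →ₗ.[ℂ] P.𝓗 :=
  sandwich (P.expL ε s) (fieldOp (P.κ ε α)) (P.expL ε (-s))

/-- The thermal field `φ'_±(s, α) = e^{i s L_±} φ(κ'_±(α)) e^{-i s L_±}`. -/
def thermalField' (ε : ℤˣ) (s : ℝ) (α : P.𝔥) : P.𝓗 →ₗ.[ℂ] P.𝓗 :=
  sandwich (P.expL ε s) (fieldOp (P.κ' ε α)) (P.expL ε (-s))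

/-- The quantization `φ(e^{-t ℓ_±} κ_±(α))` of the time-`t` field smeared with `α`,
`0 ≤ t ≤ β / 2`. -/
def quantizedField (ε : ℤˣ) (t : ℝ) (h0 : 0 ≤ t) (h1 : t ≤ P.β / 2) (α : P.𝔥) :
    P.𝓗 →ₗ.[ℂ] P.𝓗 := fieldOp (P.sharpTime ε t h0 h1 α)

/-- The time-zero field. -/
def quantizedFieldZero (ε : ℤˣ) (α : P.𝔥) : P.𝓗 →ₗ.[ℂ] P.𝓗 :=
  P.quantizedField ε 0 le_rfl P.half_β_nonneg α

/-- The time-`β/2` field. -/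
def quantizedFieldHalf (ε : ℤˣ) (α : P.𝔥) : P.𝓗 →ₗ.[ℂ] P.𝓗 :=
  P.quantizedField ε (P.β / 2) P.half_β_nonneg le_rfl α

/-- The complex-linear field that agrees with `Ψ` at real test functions:
`α ↦ Ψ(Re α) + i Ψ(Im α)`. -/
def complexLinear (Ψ : P.𝔥 → P.𝓗 →ₗ.[ℂ] P.𝓗) (α : P.𝔥) : P.𝓗 →ₗ.[ℂ] P.𝓗 :=
  Ψ (P.rePart α) + I • Ψ (P.imPart α)

/-- `𝓡_0^± = {φ_±(s, α) | s ∈ ℝ, α ∈ 𝔥}''`. -/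
def algebraZero (ε : ℤˣ) : Set (P.𝓗 →L[ℂ] P.𝓗) :=
  generatedAlgebra {A | ∃ s α, A = P.thermalField ε s α}

/-- `𝓡_{β/2}^± = {φ'_±(s, α) | s ∈ ℝ, α ∈ 𝔥}''`. -/
def algebraHalf (ε : ℤˣ) : Set (P.𝓗 →L[ℂ] P.𝓗) :=
  generatedAlgebra {A | ∃ s α, A = P.thermalField' ε s α}

end Params

end ThermalField

end

noncomputable section

namespace ThermalField

open Filter Topology UniformSpace

/-! ## Symmetric operators with a dense set of entire vectors -/

/-! By the canonical commutation relations, `φ(F)` and `φ(G)` commute on the product vectors as soon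
as `⟪F, G⟫` is real. For `F = e^{isℓ} κ(α)` and `G = e^{is'ℓ} κ'(α')`, the first summand of `H₁`
contributes an integral with weight `ρ^{1/2} (1 + ρ)^{1/2}`. The second summand, a conjugate space,
contributes the complex conjugate of the same integral, so `⟪F, G⟫` is real
(`inner_evolve₁_κ_comm`). The time-`β/2` fields are covered because `e^{-βμ/2} (1 + ρ)^{1/2} =
ρ^{1/2}`, so that `e^{-βℓ/2}` takes `κ(α)` to `κ'(α)`.

Commuting on a common dense invariant domain does not in general make the von Neumann algebras of
unbounded operators commute. Here every vector of the domain is entire for every field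
(`isEntire_field`), so the unitaries `e^{itφ(F)}` are given on it by exponential series. If `φ(F)`
and `φ(G)` commute on the domain, the partial sums of these series preserve the graph of `φ(G)`,
hence `e^{itφ(F)}` preserves its closure (`unitary_mem_closedGraph`). Conversely, a bounded operator
that commutes with all `e^{itφ(F)}` commutes with the closed operator `φ(F)`, since the generator of
the group is contained in that closure (`mem_closedGraph_of_hasDerivAt`). These two facts give
`generatedAlgebra_commute`. -/

theorem sum_antidiagonal_pow_div_factorial {𝕜 : Type*} [Field 𝕜] [CharZero 𝕜] (a b : 𝕜) (N : ℕ) :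
    ∑ p ∈ Finset.HasAntidiagonal.antidiagonal N,
      (a ^ p.1 / (p.1.factorial : 𝕜)) * (b ^ p.2 / (p.2.factorial : 𝕜)) =
        (a + b) ^ N / (N.factorial : 𝕜) := by
  rw [(Commute.all a b).add_pow', Finset.sum_div]
  refine Finset.sum_congr rfl fun p hp => ?_
  obtain rfl := Finset.HasAntidiagonal.mem_antidiagonal.1 hp
  have h := Nat.add_choose_mul_factorial_mul_factorial p.1 p.2
  rw [← Nat.choose_symm_add] at h
  have h' : ((p.1 + p.2).choose p.1 : 𝕜) * p.1.factorial * p.2.factorial =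
      (p.1 + p.2).factorial := by exact_mod_cast h
  have h1 : (p.1.factorial : 𝕜) ≠ 0 := by exact_mod_cast p.1.factorial_ne_zero
  have h2 : (p.2.factorial : 𝕜) ≠ 0 := by exact_mod_cast p.2.factorial_ne_zero
  have h3 : ((p.1 + p.2).factorial : 𝕜) ≠ 0 := by exact_mod_cast (p.1 + p.2).factorial_ne_zero
  rw [nsmul_eq_mul]
  field_simp
  rw [← h']
  ring

/-- Rearrangement of the exponential series of a sum into a double series. -/
theorem hasSum_expSeries_add {H : Type*} [NormedAddCommGroup H] [NormedSpace ℂ H] [CompleteSpace H]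
    (c : ℕ → H) (hc : ∀ r : ℝ, 0 ≤ r → Summable fun k : ℕ => r ^ k / k.factorial * ‖c k‖)
    (a b : ℂ) :
    HasSum (fun j : ℕ => (a ^ j / (j.factorial : ℂ)) •
        ∑' k : ℕ, (b ^ k / (k.factorial : ℂ)) • c (j + k))
      (∑' N : ℕ, ((a + b) ^ N / (N.factorial : ℂ)) • c N) := by
  set F : ℕ × ℕ → H := fun p =>
    ((a ^ p.1 / (p.1.factorial : ℂ)) * (b ^ p.2 / (p.2.factorial : ℂ))) • c (p.1 + p.2) with hF
  -- Summed along antidiagonals, the norms form the exponential series at `‖a‖ + ‖b‖`, by the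
  -- binomial theorem.
  have hnorm : Summable fun p => ‖F p‖ := by
    rw [← Finset.HasAntidiagonal.sigmaAntidiagonalEquivProd.summable_iff]
    refine (summable_sigma_of_nonneg fun _ => norm_nonneg _).2
      ⟨fun N => Summable.of_finite, ?_⟩
    refine (hc (‖a‖ + ‖b‖) (by positivity)).congr fun N => ?_
    rw [tsum_fintype, ← sum_antidiagonal_pow_div_factorial, Finset.sum_mul,
      ← Finset.sum_coe_sort (Finset.HasAntidiagonal.antidiagonal N)]
    refine Finset.sum_congr rfl fun p _ => ?_
    have hp := Finset.HasAntidiagonal.mem_antidiagonal.1 p.2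
    simp [hF, norm_smul, hp]
  have hsum : Summable F := hnorm.of_norm
  have h1 : ∑' p, F p = ∑' N : ℕ, ((a + b) ^ N / (N.factorial : ℂ)) • c N := by
    rw [← Finset.HasAntidiagonal.sigmaAntidiagonalEquivProd.tsum_eq]
    refine (Summable.tsum_sigma' (fun N => Summable.of_finite)
        (Finset.HasAntidiagonal.sigmaAntidiagonalEquivProd.summable_iff.2 hsum)).trans
      (tsum_congr fun N => ?_)
    rw [tsum_fintype, ← sum_antidiagonal_pow_div_factorial, Finset.sum_smul,
      ← Finset.sum_coe_sort (Finset.HasAntidiagonal.antidiagonal N)]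
    refine Finset.sum_congr rfl fun p _ => ?_
    have hp := Finset.HasAntidiagonal.mem_antidiagonal.1 p.2
    simp [hF, hp]
  rw [← h1]
  refine HasSum.prod_fiberwise (f := F) hsum.hasSum fun j => ?_
  have h2 : Summable fun k => F (j, k) := hsum.comp_injective fun k k' h => (Prod.mk.inj h).2
  rw [← tsum_const_smul'']
  simp only [smul_smul]
  exact h2.hasSum

variable {E : Type*} [SeminormedAddCommGroup E] [InnerProductSpace ℂ E]

/-- All vectors are entire vectors of `T`. -/
def IsEntire (T : E →ₗ[ℂ] E) : Prop :=
  ∀ (f : E) (r : ℝ), 0 ≤ r → Summable fun k : ℕ => r ^ k / k.factorial * ‖(T ^ k) f‖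

/-- The vector `e^{z T} f` in the completion. -/
def expVec (T : E →ₗ[ℂ] E) (z : ℂ) (f : E) : Completion E :=
  ∑' k : ℕ, (z ^ k / (k.factorial : ℂ)) • (((T ^ k) f : E) : Completion E)

theorem IsEntire.hasSum_expVec {T : E →ₗ[ℂ] E} (hT : IsEntire T) (z : ℂ) (f : E) :
    HasSum (fun k : ℕ => (z ^ k / (k.factorial : ℂ)) • (((T ^ k) f : E) : Completion E))
      (expVec T z f) := by
  refine Summable.hasSum (Summable.of_norm ?_)
  refine (hT f ‖z‖ (norm_nonneg _)).congr fun k => ?_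
  simp [norm_smul]

/-- The group law in series form: `expVec T b f` lies in the completion, where `T` is not defined,
so `e^{aT}` cannot be applied to it directly. -/
theorem IsEntire.hasSum_expVec_add {T : E →ₗ[ℂ] E} (hT : IsEntire T) (a b : ℂ) (f : E) :
    HasSum (fun j : ℕ => (a ^ j / (j.factorial : ℂ)) • expVec T b ((T ^ j) f))
      (expVec T (a + b) f) := by
  have h := hasSum_expSeries_add (fun k => (((T ^ k) f : E) : Completion E))
    (fun r hr => (hT f r hr).congr fun k => by rw [Completion.norm_coe]) a b
  refine h.congr_fun ?_
  intro j
  simp only [expVec, add_comm j, pow_add, Module.End.mul_apply]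

theorem IsEntire.inner_expVec_coe {T : E →ₗ[ℂ] E} (hT : IsEntire T) (hs : T.IsSymmetric) (z : ℂ)
    (f g : E) : ⟪expVec T z f, (g : Completion E)⟫_ℂ = ⟪(f : Completion E), expVec T (conj z) g⟫_ℂ := by
  have h1 := (innerSL ℂ (g : Completion E)).hasSum (hT.hasSum_expVec z f)
  have h2 := (innerSL ℂ (f : Completion E)).hasSum (hT.hasSum_expVec (conj z) g)
  have h3 := (Complex.hasSum_conj' (f := _)).2 h1
  simp only [innerSL_apply_apply, inner_conj_symm] at h2 h3
  refine h3.unique (h2.congr_fun ?_)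
  intro k
  simp only [inner_smul_left, inner_smul_right, Completion.inner_coe, map_div₀, map_pow,
    Complex.conj_natCast, (hs.pow k) f g]

/-- Only the left exponential is expanded; its powers of `T` move to `g`, and `hasSum_expVec_add`
resums. Both the isometry property and the group law come from this formula. -/
theorem IsEntire.inner_expVec {T : E →ₗ[ℂ] E} (hT : IsEntire T) (hs : T.IsSymmetric) (a b : ℂ)
    (f g : E) : ⟪expVec T a f, expVec T b g⟫_ℂ =
      ⟪(f : Completion E), expVec T (conj a + b) g⟫_ℂ := by
  have h1 := (innerSL ℂ (expVec T b g)).hasSum (hT.hasSum_expVec a f)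
  have h2 := (innerSL ℂ (f : Completion E)).hasSum (hT.hasSum_expVec_add (conj a) b g)
  have h3 := (Complex.hasSum_conj' (f := _)).2 h1
  simp only [innerSL_apply_apply, inner_conj_symm] at h2 h3
  refine h3.unique (h2.congr_fun ?_)
  intro k
  -- Symmetry of `T ^ k` cannot be used against `expVec T b g`, so the exponential is first moved to
  -- the other side and the power is moved term by term.
  have h4 : ⟪(((T ^ k) f : E) : Completion E), expVec T b g⟫_ℂ =
      ⟪(f : Completion E), expVec T b ((T ^ k) g)⟫_ℂ := by
    rw [← inner_conj_symm, ← inner_conj_symm (f : Completion E)]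
    congr 1
    rw [hT.inner_expVec_coe hs, hT.inner_expVec_coe hs]
    have h5 := (innerSL ℂ (g : Completion E)).hasSum (hT.hasSum_expVec (conj b) ((T ^ k) f))
    have h6 := (innerSL ℂ (((T ^ k) g : E) : Completion E)).hasSum (hT.hasSum_expVec (conj b) f)
    simp only [innerSL_apply_apply] at h5 h6
    refine h5.unique (h6.congr_fun ?_)
    intro j
    simp only [inner_smul_right, Completion.inner_coe, (hs.pow k) g, ← Module.End.mul_apply,
      ← pow_add, add_comm]
  simp only [inner_smul_left, inner_smul_right, map_div₀, map_pow, Complex.conj_natCast, h4]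

theorem expVec_zero (T : E →ₗ[ℂ] E) (f : E) : expVec T 0 f = f := by
  unfold expVec
  rw [tsum_eq_single 0 fun k hk => by simp [hk]]
  simp

theorem conj_I_mul (t : ℝ) : conj (I * (t : ℂ)) = I * ((-t : ℝ) : ℂ) := by
  simp

/-- The exponents `conj (I * t)` and `I * t` cancel in `inner_expVec`. -/
theorem IsEntire.norm_expVec {T : E →ₗ[ℂ] E} (hT : IsEntire T) (hs : T.IsSymmetric) (t : ℝ)
    (f : E) : ‖expVec T (I * t) f‖ = ‖f‖ := by
  have h := hT.inner_expVec hs (I * t) (I * t) f f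
  rw [conj_I_mul, ← mul_add, ← Complex.ofReal_add, neg_add_cancel, Complex.ofReal_zero, mul_zero,
    expVec_zero, Completion.inner_coe, inner_self_eq_norm_sq_to_K, inner_self_eq_norm_sq_to_K] at h
  have h2 : ‖expVec T (I * t) f‖ ^ 2 = ‖f‖ ^ 2 := by exact_mod_cast h
  exact (sq_eq_sq₀ (norm_nonneg _) (norm_nonneg _)).1 h2

theorem IsEntire.hasDerivAt_expVec {T : E →ₗ[ℂ] E} (hT : IsEntire T) (f : E) :
    HasDerivAt (fun z => expVec T z f) ((T f : E) : Completion E) 0 := by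
  let p : FormalMultilinearSeries ℂ ℂ (Completion E) := fun k =>
    ContinuousMultilinearMap.mkPiRing ℂ (Fin k)
      (((k.factorial : ℂ))⁻¹ • (((T ^ k) f : E) : Completion E))
  have hp : HasFPowerSeriesAt (fun z => expVec T z f) p 0 := by
    refine hasFPowerSeriesAt_iff.2 (Eventually.of_forall fun z => ?_)
    rw [zero_add]
    refine (hT.hasSum_expVec z f).congr_fun fun k => ?_
    simp [p, FormalMultilinearSeries.coeff, smul_smul, div_eq_mul_inv]
  have := hp.hasDerivAt
  simpa [p] using this

/-- `f ↦ e^{z T} f` as a linear map into the completion. -/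
def IsEntire.expLinear {T : E →ₗ[ℂ] E} (hT : IsEntire T) (z : ℂ) : E →ₗ[ℂ] Completion E where
  toFun := expVec T z
  map_add' f g := by
    refine (hT.hasSum_expVec z (f + g)).unique
      (((hT.hasSum_expVec z f).add (hT.hasSum_expVec z g)).congr_fun fun k => ?_)
    rw [map_add, Completion.coe_add, smul_add]
  map_smul' c f := by
    refine (hT.hasSum_expVec z (c • f)).unique
      (((hT.hasSum_expVec z f).const_smul c).congr_fun fun k => ?_)
    rw [map_smul, Completion.coe_smul, smul_comm]

/-- The unitary `e^{i t T}` generated by the symmetric operator `T` with entire vectors. -/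
def IsEntire.unitary {T : E →ₗ[ℂ] E} (hT : IsEntire T) (hs : T.IsSymmetric) (t : ℝ) :
    Completion E →L[ℂ] Completion E :=
  ((hT.expLinear (I * t)).mkContinuous 1 fun f => by
    rw [one_mul]; exact (hT.norm_expVec hs t f).le).extend Completion.toComplL

/-! ### The strongly continuous unitary group generated by an entire symmetric operator. -/

section Group

variable {T : E →ₗ[ℂ] E} (hT : IsEntire T) (hs : T.IsSymmetric)
include hT hs

theorem IsEntire.unitary_coe (t : ℝ) (f : E) : hT.unitary hs t f = expVec T (I * t) f :=
  ContinuousLinearMap.extend_eq _ (Completion.denseRange_coe) (Completion.isUniformInducing_coe E) f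

theorem IsEntire.norm_unitary (t : ℝ) (x : Completion E) : ‖hT.unitary hs t x‖ = ‖x‖ := by
  refine Completion.induction_on x (isClosed_eq (by fun_prop) (by fun_prop)) fun f => ?_
  rw [unitary_coe, hT.norm_expVec hs, Completion.norm_coe]

theorem IsEntire.inner_unitary_left (t : ℝ) (x y : Completion E) :
    ⟪hT.unitary hs t x, y⟫_ℂ = ⟪x, hT.unitary hs (-t) y⟫_ℂ := by
  refine Completion.induction_on₂ x y (isClosed_eq (by fun_prop) (by fun_prop)) fun f g => ?_
  rw [unitary_coe, unitary_coe, hT.inner_expVec_coe hs, conj_I_mul]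

theorem IsEntire.adjoint_unitary (t : ℝ) :
    ContinuousLinearMap.adjoint (hT.unitary hs t) = hT.unitary hs (-t) := by
  refine ((ContinuousLinearMap.eq_adjoint_iff _ _).2 fun x y => ?_).symm
  rw [inner_unitary_left, neg_neg]

/-- Tested against `g`, the outer unitary moves to the left with time `-s`; both exponentials then
act on vectors of `E`, and `inner_expVec` adds the exponents. -/
theorem IsEntire.unitary_add (s t : ℝ) (x : Completion E) :
    hT.unitary hs s (hT.unitary hs t x) = hT.unitary hs (s + t) x := by
  refine ext_inner_left ℂ fun y => ?_
  refine Completion.induction_on₂ x y (isClosed_eq (by fun_prop) (by fun_prop)) fun f g => ?_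
  have h := hT.inner_unitary_left hs (-s) (g : Completion E) (hT.unitary hs t f)
  rw [neg_neg] at h
  rw [← h, unitary_coe, unitary_coe, unitary_coe, hT.inner_expVec hs, conj_I_mul, ← mul_add,
    neg_neg, ← Complex.ofReal_add]

theorem IsEntire.unitary_zero (x : Completion E) : hT.unitary hs 0 x = x := by
  refine Completion.induction_on x (isClosed_eq (by fun_prop) (by fun_prop)) fun f => ?_
  rw [unitary_coe, Complex.ofReal_zero, mul_zero, expVec_zero]

theorem IsEntire.hasDerivAt_unitary_zero (f : E) :
    HasDerivAt (fun t : ℝ => hT.unitary hs t f) (I • ((T f : E) : Completion E)) 0 := by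
  have h1 : HasDerivAt (fun t : ℝ => I * (t : ℂ)) I 0 := by
    simpa using (Complex.ofRealCLM.hasDerivAt (x := (0 : ℝ))).const_mul I
  have h2 : HasDerivAt (fun z => expVec T z f) ((T f : E) : Completion E) (I * ((0 : ℝ) : ℂ)) := by
    simpa using hT.hasDerivAt_expVec f
  have h3 := h2.scomp (0 : ℝ) h1
  refine h3.congr_of_eventuallyEq (Eventually.of_forall fun t => ?_)
  exact hT.unitary_coe hs t f

/-- Writing `U(s) f = U(t) U(s - t) f` transports the derivative at `0` by the bounded operator
`U(t)`. -/
theorem IsEntire.hasDerivAt_unitary (f : E) (t : ℝ) :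
    HasDerivAt (fun t : ℝ => hT.unitary hs t f)
      (I • hT.unitary hs t ((T f : E) : Completion E)) t := by
  have h1 := hT.hasDerivAt_unitary_zero hs f
  have h2 : HasDerivAt (fun s : ℝ => s - t) 1 t := by simpa using (hasDerivAt_id t).sub_const t
  rw [← sub_self t] at h1
  have h3 := HasDerivAt.scomp (h := fun s : ℝ => s - t) t h1 h2
  have h4 := ((hT.unitary hs t).restrictScalars ℝ).hasFDerivAt.comp_hasDerivAt t h3
  rw [one_smul] at h4
  have h5 : HasDerivAt (fun s : ℝ => hT.unitary hs t (hT.unitary hs (s - t) f))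
      (hT.unitary hs t (I • ((T f : E) : Completion E))) t := h4
  simpa only [unitary_add, add_sub_cancel, map_smul] using h5

theorem IsEntire.continuous_unitary (x : Completion E) :
    Continuous fun t : ℝ => hT.unitary hs t x := by
  have hd : x ∈ closure (Set.range ((↑) : E → Completion E)) := Completion.denseRange_coe x
  refine continuous_iff_continuousAt.2 fun t => Metric.continuousAt_iff'.2 fun δ hδ => ?_
  obtain ⟨_, ⟨f, rfl⟩, hf⟩ := Metric.mem_closure_iff.1 hd (δ / 3) (by positivity)
  have hc : ContinuousAt (fun t : ℝ => hT.unitary hs t f) t :=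
    (hT.hasDerivAt_unitary hs f t).continuousAt
  filter_upwards [Metric.continuousAt_iff'.1 hc (δ / 3) (by positivity)] with s hs'
  have h (r : ℝ) : dist (hT.unitary hs r x) (hT.unitary hs r f) = dist x f := by
    rw [dist_eq_norm, dist_eq_norm, ← map_sub, norm_unitary]
  have h1 := dist_triangle4 (hT.unitary hs s x) (hT.unitary hs s f) (hT.unitary hs t f)
    (hT.unitary hs t x)
  rw [h, dist_comm (hT.unitary hs t f) (hT.unitary hs t x), h] at h1
  linarith

end Group

/-! ## The closure of an entire symmetric operator -/

/-- The closure of the graph of `T`, as a subspace of the square of the completion. -/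
def closedGraph (T : E →ₗ[ℂ] E) : Submodule ℂ (Completion E × Completion E) :=
  (LinearMap.range ((Completion.toComplₗᵢ (𝕜 := ℂ) (E := E)).toLinearMap.prod
    ((Completion.toComplₗᵢ (𝕜 := ℂ) (E := E)).toLinearMap ∘ₗ T))).topologicalClosure

theorem isClosed_closedGraph (T : E →ₗ[ℂ] E) :
    IsClosed (closedGraph T : Set (Completion E × Completion E)) :=
  Submodule.isClosed_topologicalClosure _

theorem mem_closedGraph (T : E →ₗ[ℂ] E) (f : E) :
    ((f : Completion E), ((T f : E) : Completion E)) ∈ closedGraph T :=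
  Submodule.le_topologicalClosure _ ⟨f, rfl⟩

theorem closedGraph_induction {T : E →ₗ[ℂ] E} {K : Set (Completion E × Completion E)}
    (hK : IsClosed K) (h : ∀ f : E, ((f : Completion E), ((T f : E) : Completion E)) ∈ K)
    {x : Completion E × Completion E} (hx : x ∈ closedGraph T) : x ∈ K := by
  refine closure_minimal ?_ hK hx
  rintro _ ⟨f, rfl⟩
  exact h f

/-- A unitary `e^{i t T}` maps the closed graph of `S` into itself if `S` and `T` commute. -/
theorem IsEntire.unitary_mem_closedGraph {T S : E →ₗ[ℂ] E} (hT : IsEntire T)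
    (hs : T.IsSymmetric) (hTS : ∀ f k, ((S ((T ^ k) f) : E) : Completion E) = (T ^ k) (S f))
    (t : ℝ) {x : Completion E × Completion E} (hx : x ∈ closedGraph S) :
    (hT.unitary hs t x.1, hT.unitary hs t x.2) ∈ closedGraph S := by
  refine closedGraph_induction (K := {x | (hT.unitary hs t x.1, hT.unitary hs t x.2) ∈
    (closedGraph S : Set (Completion E × Completion E))})
    ((isClosed_closedGraph S).preimage (by fun_prop)) (fun f => ?_) hx
  simp only [Set.mem_ofPred_eq, SetLike.mem_coe, unitary_coe]
  -- The two series converge jointly. Each pair of partial sums lies in the graph of `S`, because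
  -- `S` commutes with `T ^ k` modulo vectors of norm zero, which the completion identifies with
  -- `0`.
  have h := (hT.hasSum_expVec (I * t) f).prodMk (hT.hasSum_expVec (I * t) (S f))
  refine (isClosed_closedGraph S).mem_of_tendsto h (Eventually.of_forall fun s => ?_)
  refine Submodule.sum_mem _ fun k _ => ?_
  rw [← hTS]
  exact Submodule.smul_mem _ _ (mem_closedGraph S ((T ^ k) f))

/-- Supplies the continuity in `y` with which `integral_mem_closedGraph` passes from `E` to its
completion. -/
theorem IsEntire.lipschitz_integral_unitary {T : E →ₗ[ℂ] E} (hT : IsEntire T)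
    (hs : T.IsSymmetric) (h : ℝ) :
    LipschitzWith ‖h‖₊ fun y => ∫ s in (0 : ℝ)..h, hT.unitary hs s y := by
  refine LipschitzWith.of_dist_le_mul fun x y => ?_
  rw [dist_eq_norm, ← intervalIntegral.integral_sub
    ((hT.continuous_unitary hs x).intervalIntegrable _ _)
    ((hT.continuous_unitary hs y).intervalIntegrable _ _)]
  refine (intervalIntegral.norm_integral_le_of_norm_le_const (C := dist x y)
    fun s _ => ?_).trans_eq ?_
  · rw [← map_sub, norm_unitary, dist_eq_norm]
  · rw [sub_zero, mul_comm, coe_nnnorm, Real.norm_eq_abs]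

/-- Integrating along the group regularizes: the fundamental theorem of calculus gives `i T ∫ U(s) f
ds = U(h) f - f` on `E`, and the right side is bounded in `f`, so the relation survives the passage
to arbitrary `y`. -/
theorem IsEntire.integral_mem_closedGraph {T : E →ₗ[ℂ] E} (hT : IsEntire T) (hs : T.IsSymmetric)
    (h : ℝ) (y : Completion E) :
    (∫ s in (0 : ℝ)..h, hT.unitary hs s y, -I • (hT.unitary hs h y - y)) ∈ closedGraph T := by
  set G := closedGraph T
  have hG : IsClosed (G : Set (Completion E × Completion E)) := isClosed_closedGraph T
  have hc : Continuous fun y : Completion E =>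
      (∫ s in (0 : ℝ)..h, hT.unitary hs s y, -I • (hT.unitary hs h y - y)) :=
    (hT.lipschitz_integral_unitary hs h).continuous.prodMk
      (((hT.unitary hs h).continuous.sub continuous_id).const_smul (-I))
  refine Completion.induction_on y (hG.preimage hc) fun f => ?_
  have hmem (s : ℝ) : (hT.unitary hs s f, hT.unitary hs s ((T f : E) : Completion E)) ∈ G := by
    refine hT.unitary_mem_closedGraph hs (fun f k => ?_) s (mem_closedGraph T f)
    rw [← Module.End.mul_apply, ← Module.End.mul_apply, ← pow_succ, ← pow_succ']
  -- The integral is taken in the closed subspace `G` itself, so its value belongs to `G`.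
  let φ : ℝ → G := fun s => ⟨_, hmem s⟩
  have hφ : Continuous φ := ((hT.continuous_unitary hs f).prodMk
    (hT.continuous_unitary hs ((T f : E) : Completion E))).subtype_mk _
  have : CompleteSpace G := hG.completeSpace_coe
  have hi := hφ.intervalIntegrable (μ := volume) 0 h
  have h1 := ((ContinuousLinearMap.fst ℂ (Completion E) (Completion E)).comp
    G.subtypeL).intervalIntegral_comp_comm hi
  have h2 := ((ContinuousLinearMap.snd ℂ (Completion E) (Completion E)).comp
    G.subtypeL).intervalIntegral_comp_comm hi
  have h3 : ∫ s in (0 : ℝ)..h, I • hT.unitary hs s ((T f : E) : Completion E) =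
      hT.unitary hs h f - f := by
    have h4 := intervalIntegral.integral_eq_sub_of_hasDerivAt (a := 0) (b := h)
      (fun s _ => hT.hasDerivAt_unitary hs f s)
      (((hT.continuous_unitary hs _).const_smul I).intervalIntegrable _ _)
    rwa [unitary_zero] at h4
  rw [intervalIntegral.integral_smul] at h3
  rw [← h3, smul_smul, neg_mul, I_mul_I, neg_neg, one_smul]
  convert (∫ s in (0 : ℝ)..h, φ s).2 using 1
  exact Prod.ext h1 h2

/-- The generator of `e^{i t T}` is contained in the closure of `T`. -/
theorem IsEntire.mem_closedGraph_of_hasDerivAt {T : E →ₗ[ℂ] E} (hT : IsEntire T)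
    (hs : T.IsSymmetric) {y z : Completion E}
    (h : HasDerivAt (fun t : ℝ => hT.unitary hs t y) (I • z) 0) : (y, z) ∈ closedGraph T := by
  have hc := hT.continuous_unitary hs y
  have h1 : HasDerivAt (fun u : ℝ => ∫ s in (0 : ℝ)..u, hT.unitary hs s y) y 0 := by
    have := intervalIntegral.integral_hasDerivAt_right (hc.intervalIntegrable 0 0)
      hc.aestronglyMeasurable.stronglyMeasurableAtFilter hc.continuousAt
    rwa [unitary_zero] at this
  -- The averages `u⁻¹ ∫₀ᵘ U(s) y ds` tend to `y` and the quotients `-i u⁻¹ (U(u) y - y)` tend to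
  -- `z`; these pairs lie in the closed graph.
  have h2 := (h1.tendsto_slope_zero).prodMk_nhds ((h.tendsto_slope_zero).const_smul (-I))
  rw [smul_smul, neg_mul, I_mul_I, neg_neg, one_smul] at h2
  refine (isClosed_closedGraph T).mem_of_tendsto h2 (Eventually.of_forall fun u => ?_)
  have h3 := ((closedGraph T).restrictScalars ℝ).smul_mem u⁻¹ (hT.integral_mem_closedGraph hs u y)
  simpa [unitary_zero, smul_comm I] using h3

/-- A bounded operator commuting with all `e^{i t T}` commutes with the closure of `T`. -/
theorem IsEntire.map_mem_closedGraph {T : E →ₗ[ℂ] E} (hT : IsEntire T) (hs : T.IsSymmetric)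
    (B : Completion E →L[ℂ] Completion E)
    (hB : ∀ t x, B (hT.unitary hs t x) = hT.unitary hs t (B x))
    {x : Completion E × Completion E} (hx : x ∈ closedGraph T) : (B x.1, B x.2) ∈ closedGraph T := by
  refine closedGraph_induction (K := {x | (B x.1, B x.2) ∈
    (closedGraph T : Set (Completion E × Completion E))})
    ((isClosed_closedGraph T).preimage (by fun_prop)) (fun f => ?_) hx
  -- Since `B` commutes with the group, the orbit of `B f` is the image under `B` of the orbit of
  -- `f`, with derivative `i B (T f)` at `0`.
  refine hT.mem_closedGraph_of_hasDerivAt hs ?_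
  have h := (B.restrictScalars ℝ).hasFDerivAt.comp_hasDerivAt (0 : ℝ)
    (hT.hasDerivAt_unitary_zero hs f)
  have h' : HasDerivAt (fun t : ℝ => B (hT.unitary hs t f))
      (B (I • ((T f : E) : Completion E))) 0 := h
  simpa only [hB, map_smul] using h'

/-! ## The fields on the symmetric Fock space -/

section FockFields

variable {V : Type} [NormedAddCommGroup V] [InnerProductSpace ℂ V]

namespace PreFock

/-- The squared norm is a permanent: `n!` terms, each of modulus at most `R ^ (2 n)`. -/
theorem norm_prodVec_le (n : ℕ) (G : Fin n → V) (R : ℝ) (hG : ∀ i, ‖G i‖ ≤ R) :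
    ‖prodVec n G‖ ≤ R ^ n * Real.sqrt n.factorial := by
  have h1 : ‖prodVec n G‖ ^ 2 ≤ (R ^ n) ^ 2 * n.factorial := by
    rw [norm_sq_eq_re_inner (𝕜 := ℂ) (prodVec n G), inner_prodVec]
    refine (RCLike.re_le_norm _).trans ?_
    unfold kernel
    refine (norm_sum_le _ _).trans ((Finset.sum_le_card_nsmul _ _ ((R ^ n) ^ 2) fun σ _ => ?_).trans
      (by simp [Fintype.card_perm, mul_comm]))
    rw [norm_prod]
    calc ∏ i, ‖⟪G i, G (σ i)⟫_ℂ‖ ≤ ∏ _i : Fin n, R * R := by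
          refine Finset.prod_le_prod (fun _ _ => norm_nonneg _) fun i _ => ?_
          exact (norm_inner_le_norm _ _).trans (mul_le_mul (hG _) (hG _) (norm_nonneg _)
            ((norm_nonneg _).trans (hG i)))
      _ = (R ^ n) ^ 2 := by simp; ring
  -- For `n = 0` the bound `hG` says nothing about the sign of `R`, but then the power is `1`.
  have hR : 0 ≤ R ^ n := by
    cases n with
    | zero => simp
    | succ n => exact pow_nonneg ((norm_nonneg _).trans (hG 0)) _
  refine le_of_sq_le_sq ?_ (by positivity)
  rwa [mul_pow, Real.sq_sqrt (by positivity)]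

/-- Powers of the field on a product vector. -/
theorem norm_field_pow_prodVec_le (F : V) (R : ℝ) (hF : ‖F‖ ≤ R) (k n : ℕ) (G : Fin n → V)
    (hG : ∀ i, ‖G i‖ ≤ R) :
    ‖(field F ^ k) (prodVec n G)‖ ≤ (2 * R) ^ k * R ^ n * Real.sqrt (n + k).factorial := by
  have hR : 0 ≤ R := (norm_nonneg _).trans hF
  induction k generalizing n G with
  | zero => simpa using norm_prodVec_le n G R hG
  | succ k ih =>
    rw [pow_succ, Module.End.mul_apply, field, LinearMap.add_apply, creation_prodVec,
      annihilation_prodVec, map_add, ← field]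
    have h1 := ih (n + 1) (Fin.cons F G) (Fin.cases hF hG)
    -- The annihilation part satisfies the same bound as the creation part; adding the two produces
    -- the factor `2` in `(2 * R) ^ k`.
    have h2 : ‖(field F ^ k) (annihilationProd F ⟨n, G⟩)‖ ≤
        (2 * R) ^ k * R ^ (n + 1) * Real.sqrt (n + 1 + k).factorial := by
      cases n with
      | zero =>
        simp only [annihilationProd, map_zero, norm_zero]
        positivity
      | succ n =>
        simp only [annihilationProd, map_sum, map_smul]
        have h3 : ∀ j : Fin (n + 1), ‖⟪F, G j⟫_ℂ • (field F ^ k)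
            (prodVec n fun i => G (j.succAbove i))‖ ≤
            R * R * ((2 * R) ^ k * R ^ n * Real.sqrt (n + k).factorial) := fun j => by
          rw [norm_smul]
          refine mul_le_mul ?_ (ih n _ fun i => hG _) (norm_nonneg _) (by positivity)
          exact (norm_inner_le_norm _ _).trans (mul_le_mul hF (hG j) (norm_nonneg _) hR)
        refine (norm_sum_le _ _).trans ((Finset.sum_le_card_nsmul _ _ _ fun j _ => h3 j).trans ?_)
        -- The `n + 1` terms, each with two factors fewer than the creation part, are absorbed
        -- through `(n + 1)² ≤ (n + k + 2)(n + k + 1)`.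
        have h4 : ((n + 1 : ℕ) : ℝ) * Real.sqrt (n + k).factorial ≤
            Real.sqrt (n + 1 + 1 + k).factorial := by
          refine Real.le_sqrt_of_sq_le ?_
          rw [mul_pow, Real.sq_sqrt (by positivity)]
          have h5 : n + 1 + 1 + k = (n + k) + 1 + 1 := by ring
          rw [h5, Nat.factorial_succ, Nat.factorial_succ, ← mul_assoc]
          push_cast
          refine mul_le_mul_of_nonneg_right ?_ (by positivity)
          have : (0 : ℝ) ≤ n := by positivity
          have : (0 : ℝ) ≤ k := by positivity
          nlinarith
        rw [Finset.card_univ, Fintype.card_fin, nsmul_eq_mul]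
        calc _ = (2 * R) ^ k * R ^ (n + 1 + 1) *
              (((n + 1 : ℕ) : ℝ) * Real.sqrt (n + k).factorial) := by ring
          _ ≤ _ := mul_le_mul_of_nonneg_left h4 (by positivity)
    refine (norm_add_le _ _).trans ((add_le_add h1 h2).trans_eq ?_)
    rw [add_right_comm n 1 k, ← add_assoc]
    ring

/-- Each term is `a * 2⁻ᵏ ≤ a² + 4⁻ᵏ`. Bounding the binomial coefficient in `(n + k)!` by `2 ^ (n +
k)` gives `a² ≤ n! 2ⁿ (8 y²)ᵏ / k!`, where `8` is `2²` from `(2 y) ^ (2 k)` times this `2`. -/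
theorem summable_pow_mul_sqrt_factorial (y : ℝ) (hy : 0 ≤ y) (n : ℕ) :
    Summable fun k : ℕ => y ^ k * Real.sqrt (n + k).factorial / k.factorial := by
  have h1 := ((Real.summable_pow_div_factorial (8 * y ^ 2)).mul_left
    ((n.factorial : ℝ) * 2 ^ n)).add
    (summable_geometric_of_lt_one (r := (4 : ℝ)⁻¹) (by norm_num) (by norm_num))
  refine Summable.of_nonneg_of_le (fun k => by positivity) (fun k => ?_) h1
  have hk : (0 : ℝ) < k.factorial := by positivity
  have h2 : ((n + k).factorial : ℝ) ≤ n.factorial * k.factorial * 2 ^ (n + k) := by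
    have h3 := Nat.add_choose_mul_factorial_mul_factorial n k
    have h4 := Nat.choose_le_two_pow (n + k) k
    have h5 : (n + k).factorial ≤ n.factorial * k.factorial * 2 ^ (n + k) := by
      rw [← h3, mul_assoc, mul_comm]
      exact Nat.mul_le_mul_left _ h4
    exact_mod_cast h5
  set a : ℝ := (2 * y) ^ k * Real.sqrt (n + k).factorial / k.factorial with ha
  have h6 : y ^ k * Real.sqrt (n + k).factorial / k.factorial = a * (2 : ℝ)⁻¹ ^ k := by
    rw [ha, mul_pow, inv_pow]
    field_simp
  have h7 : a ^ 2 ≤ (n.factorial : ℝ) * 2 ^ n * ((8 * y ^ 2) ^ k / k.factorial) := by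
    rw [ha, div_pow, mul_pow, Real.sq_sqrt (by positivity), div_le_iff₀ (by positivity)]
    calc _ ≤ ((2 * y) ^ k) ^ 2 * (n.factorial * k.factorial * 2 ^ (n + k)) :=
          mul_le_mul_of_nonneg_left h2 (by positivity)
      _ = _ := by
          have : (8 : ℝ) ^ k = 2 ^ k * (2 ^ k * 2 ^ k) := by rw [← mul_pow, ← mul_pow]; norm_num
          field_simp
          rw [mul_pow (y ^ 2), this]
          ring
  have h8 : ((2 : ℝ)⁻¹ ^ k) ^ 2 = (4 : ℝ)⁻¹ ^ k := by rw [← pow_mul, mul_comm, pow_mul]; norm_num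
  rw [h6]
  nlinarith [sq_nonneg (a - (2 : ℝ)⁻¹ ^ k), sq_nonneg (a + (2 : ℝ)⁻¹ ^ k)]

theorem isEntire_field (F : V) : IsEntire (field F) := by
  intro f r hr
  refine induction_prodVec (P := fun f => Summable fun k : ℕ =>
    r ^ k / k.factorial * ‖(field F ^ k) f‖) f ?_ (fun f g hf hg => ?_) (fun c f hf => ?_)
    fun q => ?_
  · simp
  · refine Summable.of_nonneg_of_le (fun k => by positivity) (fun k => ?_) (hf.add hg)
    rw [← mul_add, map_add]
    exact mul_le_mul_of_nonneg_left (norm_add_le _ _) (by positivity)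
  · refine (hf.mul_left ‖c‖).congr fun k => ?_
    rw [map_smul, norm_smul]
    ring
  · obtain ⟨n, G⟩ := q
    -- A single bound for `F` and all factors of the product.
    set R : ℝ := ‖F‖ + ∑ i, ‖G i‖ with hR
    have hs : 0 ≤ ∑ i, ‖G i‖ := Finset.sum_nonneg fun _ _ => norm_nonneg _
    have hG : ∀ i, ‖G i‖ ≤ R := fun i => by
      have := Finset.single_le_sum (fun i _ => norm_nonneg (G i)) (Finset.mem_univ i)
      linarith [norm_nonneg F]
    have h0 : 0 ≤ R := by positivity
    refine Summable.of_nonneg_of_le (fun k => by positivity) (fun k => ?_)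
      ((summable_pow_mul_sqrt_factorial (2 * R * r) (by positivity) n).mul_left (R ^ n))
    refine (mul_le_mul_of_nonneg_left (norm_field_pow_prodVec_le F R (by linarith) k n G hG)
      (by positivity)).trans_eq ?_
    rw [mul_pow (2 * R) r]
    ring

theorem isSymmetric_field (F : V) : (field F).IsSymmetric := inner_field F

/-! ### Commutation relations -/

/-- `PreFock V` has nonzero null vectors, so identities such as Bose symmetry hold only after
`toFock`; this reduces them to inner products. -/
theorem toFock_eq_iff {f g : PreFock V} : toFock f = toFock g ↔ ∀ h, ⟪f, h⟫_ℂ = ⟪g, h⟫_ℂ := by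
  have hi : ∀ f g : PreFock V, ⟪toFock f, toFock g⟫_ℂ = ⟪f, g⟫_ℂ :=
    fun f g => UniformSpace.Completion.inner_coe f g
  refine ⟨fun e h => by rw [← hi, ← hi, e], fun e => ?_⟩
  rw [← sub_eq_zero, ← map_sub, ← inner_self_eq_zero (𝕜 := ℂ), hi, inner_sub_left, e, sub_self]

/-- Permuting the factors only reindexes the permanent. -/
theorem toFock_prodVec_comp_perm (n : ℕ) (G : Fin n → V) (σ : Equiv.Perm (Fin n)) :
    toFock (prodVec n (G ∘ σ)) = toFock (prodVec n G) := by
  refine toFock_eq_iff.2 fun h => induction_prodVec (P := fun h =>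
    ⟪prodVec n (G ∘ σ), h⟫_ℂ = ⟪prodVec n G, h⟫_ℂ) h (by simp only [inner_zero_right])
    (fun f g hf hg => by simp only [inner_add_right, hf, hg])
    (fun c f hf => by simp only [inner_smul_right, hf]) fun q => ?_
  rw [inner_prodVec, inner_prodVec]
  unfold kernel
  refine Fintype.sum_equiv ⟨fun e => σ.symm.trans e, fun e => σ.trans e, fun e => by ext; simp,
    fun e => by ext; simp⟩ _ _ fun e => ?_
  exact Fintype.prod_equiv σ _ _ fun i => by simp

theorem toFock_creation_comm (F G : V) (f : PreFock V) :
    toFock (creation F (creation G f)) = toFock (creation G (creation F f)) := by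
  refine induction_prodVec (P := fun f =>
    toFock (creation F (creation G f)) = toFock (creation G (creation F f))) f (by simp)
    (fun f g hf hg => by simp only [map_add, hf, hg]) (fun c f hf => by simp only [map_smul, hf])
    fun q => ?_
  simp only [creation_prodVec]
  rw [← toFock_prodVec_comp_perm _ (Fin.cons G (Fin.cons F q.2)) (Equiv.swap 0 1)]
  congr 2
  funext i
  refine Fin.cases (by simp) (fun i => Fin.cases (by simp) (fun i => ?_) i) i
  rw [Function.comp_apply, Equiv.swap_apply_of_ne_of_ne (a := 0) (b := 1) (Fin.succ_ne_zero _)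
    (fun h => Fin.succ_ne_zero i (Fin.succ_injective _ (h.trans Fin.succ_zero_eq_one.symm)))]
  simp

theorem toFock_annihilation_comm (F G : V) (f : PreFock V) :
    toFock (annihilation F (annihilation G f)) = toFock (annihilation G (annihilation F f)) := by
  refine toFock_eq_iff.2 fun h => ?_
  rw [← inner_conj_symm, ← inner_conj_symm (annihilation G _), ← inner_creation, ← inner_creation,
    ← inner_creation, ← inner_creation, toFock_eq_iff.1 (toFock_creation_comm G F h)]

/-- This relation holds already before null vectors are divided out: the term `j = 0` removes the
new factor `G`, and the others leave it in first place. -/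
theorem annihilation_creation (F G : V) (f : PreFock V) :
    annihilation F (creation G f) = creation G (annihilation F f) + ⟪F, G⟫_ℂ • f := by
  refine induction_prodVec (P := fun f => annihilation F (creation G f) =
    creation G (annihilation F f) + ⟪F, G⟫_ℂ • f) f (by simp)
    (fun f g hf hg => by simp only [map_add, hf, hg, smul_add]; abel)
    (fun c f hf => by simp only [map_smul, hf, smul_add, smul_comm c]) fun q => ?_
  obtain ⟨n, q⟩ := q
  simp only [creation_prodVec, annihilation_prodVec, annihilationProd]
  rw [Fin.sum_univ_succ, add_comm]
  congr 1
  cases n with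
  | zero => simp
  | succ n =>
    simp only [map_sum, map_smul, creation_prodVec, Fin.cons_succ]
    refine Finset.sum_congr rfl fun j _ => ?_
    congr 2
    funext i
    refine Fin.cases (by simp) (fun i => by simp) i

/-- Fields commute on the product vectors if the imaginary part of the inner product vanishes. -/
theorem toFock_field_comm {F G : V} (h : ⟪F, G⟫_ℂ = ⟪G, F⟫_ℂ) (f : PreFock V) :
    toFock (field F (field G f)) = toFock (field G (field F f)) := by
  simp only [field, LinearMap.add_apply, map_add, annihilation_creation, toFock_creation_comm F G,
    toFock_annihilation_comm F G, h]
  abel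

/-- A symmetric operator respects null vectors, so an identity in the Fock space persists under a
further field. -/
theorem toFock_field_congr (F : V) {f g : PreFock V} (h : toFock f = toFock g) :
    toFock (field F f) = toFock (field F g) := by
  refine toFock_eq_iff.2 fun k => ?_
  rw [inner_field, inner_field, toFock_eq_iff.1 h]

theorem toFock_field_pow_comm {F G : V} (h : ⟪F, G⟫_ℂ = ⟪G, F⟫_ℂ) (f : PreFock V) (k : ℕ) :
    toFock (field G ((field F ^ k) f)) = toFock ((field F ^ k) (field G f)) := by
  induction k with
  | zero => simp
  | succ k ih =>
    rw [pow_succ', Module.End.mul_apply, Module.End.mul_apply, ← toFock_field_comm h]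
    exact toFock_field_congr F ih

end PreFock

end FockFields

/-! ### Closed field operators and their covariance under second quantization. -/

section FieldOperators

variable {V : Type} [NormedAddCommGroup V] [InnerProductSpace ℂ V]

theorem graph_fieldOp (F : V) : (fieldOp F).graph = closedGraph (PreFock.field F) := by
  unfold fieldOp
  rw [← (fieldOnFinite_isClosable F).graph_closure_eq_closure_graph]
  unfold fieldOnFinite
  rw [Submodule.toLinearPMap_graph_eq _ fun x hx h => fieldGraph_single_valued F x hx h]
  rfl

theorem secondQuantization_toFock (U : V →ₗᵢ[ℂ] V) (f : PreFock V) :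
    secondQuantization U (PreFock.toFock f) = PreFock.toFock (PreFock.map U f) :=
  ContinuousLinearMap.completion_apply_coe _ f

/-- The creation part is covariant by construction, the annihilation part because `U` preserves the
coefficients `⟪F, G j⟫`. -/
theorem PreFock.map_field (U : V →ₗᵢ[ℂ] V) (F : V) (f : PreFock V) :
    map U (field F f) = field (U F) (map U f) := by
  refine induction_prodVec (P := fun f => map U (field F f) = field (U F) (map U f)) f
    (by simp only [map_zero]) (fun f g hf hg => by simp only [map_add, hf, hg])
    (fun c f hf => by simp only [map_smul, hf]) fun q => ?_
  obtain ⟨n, q⟩ := q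
  simp only [field, LinearMap.add_apply, map_add, map_prodVec, creation_prodVec,
    annihilation_prodVec]
  congr 1
  · congr 1
    funext i
    exact Fin.cases rfl (fun i => rfl) i
  · cases n with
    | zero => simp [annihilationProd]
    | succ n => simp [annihilationProd, map_prodVec]

theorem secondQuantization_mem_closedGraph (U : V →ₗᵢ[ℂ] V) (F : V) {x : Fock V × Fock V}
    (hx : x ∈ closedGraph (PreFock.field F)) :
    (secondQuantization U x.1, secondQuantization U x.2) ∈
      closedGraph (PreFock.field (U F)) := by
  refine closedGraph_induction (K := {x | (secondQuantization U x.1, secondQuantization U x.2) ∈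
    (closedGraph (PreFock.field (U F)) : Set (Fock V × Fock V))})
    ((isClosed_closedGraph _).preimage (by fun_prop)) (fun f => ?_) hx
  have h := mem_closedGraph (PreFock.field (U F)) (PreFock.map U f)
  rw [← PreFock.map_field] at h
  have h1 := secondQuantization_toFock U f
  have h2 := secondQuantization_toFock U (PreFock.field F f)
  exact (congrArg₂ (fun a b => (a, b) ∈ closedGraph (PreFock.field (U F))) h1 h2).mpr h

theorem secondQuantization_comp_of_leftInverse {U U' : V →ₗᵢ[ℂ] V} (h : ∀ x, U (U' x) = x)
    (x : Fock V) : secondQuantization U (secondQuantization U' x) = x := by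
  refine Completion.induction_on x (isClosed_eq (by fun_prop) (by fun_prop)) fun f => ?_
  change secondQuantization U (secondQuantization U' (PreFock.toFock f)) = PreFock.toFock f
  rw [secondQuantization_toFock, secondQuantization_toFock]
  congr 1
  refine PreFock.induction_prodVec (P := fun f => PreFock.map U (PreFock.map U' f) = f) f
    (by simp only [map_zero]) (fun f g hf hg => by simp only [map_add, hf, hg])
    (fun c f hf => by simp only [map_smul, hf]) fun q => ?_
  simp only [PreFock.map_prodVec, h]

theorem mem_graph_sandwich {H : Type} [NormedAddCommGroup H] [InnerProductSpace ℂ H]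
    (W : H →L[ℂ] H) (A : H →ₗ.[ℂ] H) (W' : H →L[ℂ] H) (x y : H) :
    (x, y) ∈ (sandwich W A W').graph ↔ ∃ z, (W' x, z) ∈ A.graph ∧ W z = y := by
  simp only [LinearPMap.mem_graph_iff]
  constructor
  · rintro ⟨⟨x, hx⟩, rfl, rfl⟩
    exact ⟨A ⟨W' x, hx⟩, ⟨⟨W' x, hx⟩, rfl, rfl⟩, rfl⟩
  · rintro ⟨z, ⟨⟨w, hw⟩, hw', rfl⟩, rfl⟩
    obtain rfl : w = W' x := hw'
    exact ⟨⟨x, hw⟩, rfl, rfl⟩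

/-- Second quantized unitaries transform the one-particle vector of a field. -/
theorem sandwich_fieldOp {U U' : V →ₗᵢ[ℂ] V} (h : ∀ x, U (U' x) = x) (h' : ∀ x, U' (U x) = x)
    (F : V) : sandwich (secondQuantization U) (fieldOp F) (secondQuantization U') =
      fieldOp (U F) := by
  refine LinearPMap.eq_of_eq_graph ?_
  ext ⟨x, y⟩
  rw [mem_graph_sandwich, graph_fieldOp, graph_fieldOp]
  constructor
  · rintro ⟨z, hz, rfl⟩
    have := secondQuantization_mem_closedGraph U F hz
    rwa [secondQuantization_comp_of_leftInverse h] at this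
  · intro hxy
    have := secondQuantization_mem_closedGraph U' (U F) hxy
    rw [h'] at this
    exact ⟨_, this, secondQuantization_comp_of_leftInverse h y⟩

/-! ### Commutators on the product vectors -/

/-- The operator `A` is defined on the product vectors, where it acts as `T`. -/
def ActsAs (A : Fock V →ₗ.[ℂ] Fock V) (T : PreFock V →ₗ[ℂ] PreFock V) : Prop :=
  ∀ f, (PreFock.toFock f, PreFock.toFock (T f)) ∈ A.graph

theorem actsAs_fieldOp (F : V) : ActsAs (fieldOp F) (PreFock.field F) := fun f => by
  rw [graph_fieldOp]
  exact mem_closedGraph _ f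

/-- Meant for `complexLinear`: the sum lives on the intersection of two domains, which still
contains the product vectors. -/
theorem ActsAs.add_smul {A A' : Fock V →ₗ.[ℂ] Fock V} {T T' : PreFock V →ₗ[ℂ] PreFock V}
    (h : ActsAs A T) (h' : ActsAs A' T') (c : ℂ) : ActsAs (A + c • A') (T + c • T') := fun f => by
  obtain ⟨⟨x, hx⟩, hxf, hA⟩ := (LinearPMap.mem_graph_iff _).1 (h f)
  obtain ⟨⟨x', hx'⟩, hxf', hA'⟩ := (LinearPMap.mem_graph_iff _).1 (h' f)
  obtain rfl : x = PreFock.toFock f := hxf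
  obtain rfl : x' = PreFock.toFock f := hxf'
  refine (LinearPMap.mem_graph_iff _).2 ⟨⟨PreFock.toFock f, hx, hx'⟩, rfl, ?_⟩
  rw [LinearPMap.add_apply, LinearPMap.smul_apply, LinearMap.add_apply, LinearMap.smul_apply,
    map_add, map_smul]
  exact congrArg₂ (fun a b => a + c • b) hA hA'

theorem ActsAs.commuteOn {A B : Fock V →ₗ.[ℂ] Fock V} {T S : PreFock V →ₗ[ℂ] PreFock V}
    (hA : ActsAs A T) (hB : ActsAs B S)
    (h : ∀ f, PreFock.toFock (T (S f)) = PreFock.toFock (S (T f))) :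
    CommuteOn (finiteVectors V) A B := by
  have key : ∀ {A : Fock V →ₗ.[ℂ] Fock V} {T : PreFock V →ₗ[ℂ] PreFock V}, ActsAs A T →
      ∀ f, ∃ hx : PreFock.toFock f ∈ A.domain, A ⟨_, hx⟩ = PreFock.toFock (T f) := by
    intro A T hA f
    obtain ⟨⟨x, hx⟩, hxf, hA⟩ := (LinearPMap.mem_graph_iff _).1 (hA f)
    obtain rfl : x = PreFock.toFock f := hxf
    exact ⟨hx, hA⟩
  rintro _ ⟨f, rfl⟩
  obtain ⟨h1, h1'⟩ := key hA f
  obtain ⟨h2, h2'⟩ := key hB f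
  -- The span of the product vectors is invariant, so both operator products are defined on it.
  obtain ⟨h3, h3'⟩ := key hA (S f)
  obtain ⟨h4, h4'⟩ := key hB (T f)
  refine ⟨h1, h2, by rwa [h2'], by rwa [h1'], ?_⟩
  simp only [h1', h2', h3', h4', h]

theorem commuteOn_fieldOp {F G : V} (h : ⟪F, G⟫_ℂ = ⟪G, F⟫_ℂ) :
    CommuteOn (finiteVectors V) (fieldOp F) (fieldOp G) :=
  (actsAs_fieldOp F).commuteOn (actsAs_fieldOp G) (PreFock.toFock_field_comm h)

theorem commuteOn_fieldOp_add_smul {F F' G G' : V} (h : ⟪F, G⟫_ℂ = ⟪G, F⟫_ℂ)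
    (h₁ : ⟪F', G⟫_ℂ = ⟪G, F'⟫_ℂ) (h₂ : ⟪F, G'⟫_ℂ = ⟪G', F⟫_ℂ) (h₃ : ⟪F', G'⟫_ℂ = ⟪G', F'⟫_ℂ)
    (c : ℂ) : CommuteOn (finiteVectors V) (fieldOp F + c • fieldOp F')
      (fieldOp G + c • fieldOp G') := by
  refine ((actsAs_fieldOp F).add_smul (actsAs_fieldOp F') c).commuteOn
    ((actsAs_fieldOp G).add_smul (actsAs_fieldOp G') c) fun f => ?_
  simp only [LinearMap.add_apply, LinearMap.smul_apply, map_add, map_smul,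
    PreFock.toFock_field_comm h, PreFock.toFock_field_comm h₁, PreFock.toFock_field_comm h₂,
    PreFock.toFock_field_comm h₃]
  simp only [smul_add]
  abel

/-! ### The generated von Neumann algebras -/

theorem boundedCommutes_iff {H : Type} [NormedAddCommGroup H] [InnerProductSpace ℂ H]
    (T : H →L[ℂ] H) (A : H →ₗ.[ℂ] H) :
    BoundedCommutes T A ↔ ∀ x ∈ A.graph, (T x.1, T x.2) ∈ A.graph := by
  constructor
  · rintro h ⟨x, y⟩ hx
    obtain ⟨x, rfl, rfl⟩ := (LinearPMap.mem_graph_iff _).1 hx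
    obtain ⟨h1, h2⟩ := h x
    exact (LinearPMap.mem_graph_iff _).2 ⟨⟨_, h1⟩, rfl, h2⟩
  · intro h x
    obtain ⟨⟨y, hy⟩, h1, h2⟩ := (LinearPMap.mem_graph_iff _).1 (h _ (A.mem_graph x))
    obtain rfl : y = T x := h1
    exact ⟨hy, h2⟩

/-- The Weyl operator `e^{i t φ(F)}`. -/
def weyl (F : V) (t : ℝ) : Fock V →L[ℂ] Fock V :=
  (PreFock.isEntire_field F).unitary (PreFock.isSymmetric_field F) t

theorem adjoint_weyl (F : V) (t : ℝ) :
    ContinuousLinearMap.adjoint (weyl F t) = weyl F (-t) :=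
  IsEntire.adjoint_unitary _ _ t

theorem boundedCommutes_weyl {F G : V} (h : ⟪F, G⟫_ℂ = ⟪G, F⟫_ℂ) (t : ℝ) :
    BoundedCommutes (weyl F t) (fieldOp G) := by
  rw [boundedCommutes_iff, graph_fieldOp]
  exact fun x hx => IsEntire.unitary_mem_closedGraph _ _
    (fun f k => PreFock.toFock_field_pow_comm h f k) t hx

theorem boundedCommutes_of_forall_weyl {F : V} {B : Fock V →L[ℂ] Fock V}
    (h : ∀ t, weyl F t * B = B * weyl F t) : BoundedCommutes B (fieldOp F) := by
  rw [boundedCommutes_iff, graph_fieldOp]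
  exact fun x hx => (PreFock.isEntire_field F).map_mem_closedGraph (PreFock.isSymmetric_field F) B
    (fun t x => (DFunLike.congr_fun (h t) x).symm) hx

/-- Two families of fields whose commutators vanish generate commuting von Neumann algebras. -/
theorem generatedAlgebra_commute {K K' : Set V} (h : ∀ F ∈ K, ∀ G ∈ K', ⟪F, G⟫_ℂ = ⟪G, F⟫_ℂ)
    {A B : Fock V →L[ℂ] Fock V} (hA : A ∈ generatedAlgebra (fieldOp '' K))
    (hB : B ∈ generatedAlgebra (fieldOp '' K')) : A * B = B * A := by
  -- Hence `B`, an element of the bicommutant of the second family, commutes with all Weyl operators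
  -- of the first.
  have hW : ∀ F ∈ K, ∀ t, weyl F t ∈ commutant (fieldOp '' K') := by
    rintro F hF t _ ⟨G, hG, rfl⟩
    rw [adjoint_weyl]
    exact ⟨boundedCommutes_weyl (h F hF G hG) t, boundedCommutes_weyl (h F hF G hG) (-t)⟩
  have hB' : B ∈ commutant (fieldOp '' K) := by
    rintro _ ⟨F, hF, rfl⟩
    refine ⟨boundedCommutes_of_forall_weyl fun t => hB _ (hW F hF t),
      boundedCommutes_of_forall_weyl fun t => ?_⟩
    -- The adjoint of the commutation of `B` with time `-t` is that of `B*` with time `t`.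
    have h1 := congrArg ContinuousLinearMap.adjoint (hB _ (hW F hF (-t)))
    have h2 : weyl F t = ContinuousLinearMap.adjoint (weyl F (-t)) := by
      rw [adjoint_weyl, neg_neg]
    rw [h2]
    exact ((ContinuousLinearMap.adjoint_comp _ _).symm.trans
      (h1.symm.trans (ContinuousLinearMap.adjoint_comp _ _)))
  exact (hA B hB').symm

end FieldOperators

/-! ## The thermal one-particle vectors -/

namespace Params

variable {n : ℕ} (P : Params n)

theorem coeFn_mulOp {σ : Momentum n → ℂ} (hσ : Measurable σ) (hb : ∃ C, ∀ k, ‖σ k‖ ≤ C)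
    (α : P.𝔥) : P.mulOp σ hσ hb α =ᵐ[P.ν] fun k => σ k * α k :=
  MemLp.coeFn_toLp (P.memLp_mul hσ hb α)

theorem coeFn_evolve (ε : ℤˣ) (s : ℝ) (α : P.𝔥) :
    P.evolve ε s α =ᵐ[P.ν] fun k => cexp (I * ((s * P.μs ε k : ℝ) : ℂ)) * α k :=
  P.coeFn_mulOp (by have := (P.continuous_μs ε).measurable; fun_prop)
    ⟨1, fun k => by rw [mul_comm, Complex.norm_exp_ofReal_mul_I]⟩ α

theorem mulOp_congr {σ τ : Momentum n → ℂ} (hσ : Measurable σ) (hb : ∃ C, ∀ k, ‖σ k‖ ≤ C)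
    (hτ : Measurable τ) (hb' : ∃ C, ∀ k, ‖τ k‖ ≤ C) (h : ∀ k, σ k = τ k) :
    P.mulOp σ hσ hb = P.mulOp τ hτ hb' := by
  obtain rfl : σ = τ := funext h
  rfl

theorem evolve_neg_evolve (ε : ℤˣ) (s : ℝ) (α : P.𝔥) :
    P.evolve ε (-s) (P.evolve ε s α) = α := by
  refine Lp.ext ?_
  filter_upwards [P.coeFn_evolve ε (-s) (P.evolve ε s α), P.coeFn_evolve ε s α] with k h1 h2
  rw [h1, h2, ← mul_assoc, ← Complex.exp_add, ← mul_add, ← Complex.ofReal_add, neg_mul,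
    neg_add_cancel]
  simp

theorem evolve₁_neg_evolve₁ (ε : ℤˣ) (s : ℝ) (x : P.H₁) :
    P.evolve₁ ε (-s) (P.evolve₁ ε s x) = x := by
  change P.pair (P.evolve ε (-s) (P.evolve ε s x.fst))
    (P.evolve ε (-s) (P.evolve ε s (ConjSpace.unbar x.snd))) = x
  rw [evolve_neg_evolve, evolve_neg_evolve]
  rfl

theorem sandwich_expL_fieldOp (ε : ℤˣ) (s : ℝ) (F : P.H₁) :
    sandwich (P.expL ε s) (fieldOp F) (P.expL ε (-s)) = fieldOp (P.evolve₁ ε s F) :=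
  sandwich_fieldOp (fun x => by simpa using P.evolve₁_neg_evolve₁ ε (-s) x)
    (P.evolve₁_neg_evolve₁ ε s) F

theorem inner_pair (x y x' y' : P.𝔥) :
    ⟪P.pair x y, P.pair x' y'⟫_ℂ = ⟪x, x'⟫_ℂ + ⟪y', y⟫_ℂ :=
  WithLp.prod_inner_apply _ _

/-- All operators are multiplications and the two square roots are real, so they can change places
under the integral. -/
theorem inner_evolve_sqrt (ε : ℤˣ) (α α' : P.𝔥) (s s' : ℝ) :
    ⟪P.evolve ε s (P.sqrtOneAddρ ε α), P.evolve ε s' (P.sqrtρ ε α')⟫_ℂ =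
      ⟪P.evolve ε s (P.sqrtρ ε α), P.evolve ε s' (P.sqrtOneAddρ ε α')⟫_ℂ := by
  rw [L2.inner_def, L2.inner_def]
  refine integral_congr_ae ?_
  have h1 : ∀ γ : P.𝔥, P.sqrtOneAddρ ε γ =ᵐ[P.ν] fun k => (Real.sqrt (1 + P.ρ ε k) : ℂ) * γ k :=
    fun γ => P.coeFn_mulOp _ _ γ
  have h2 : ∀ γ : P.𝔥, P.sqrtρ ε γ =ᵐ[P.ν] fun k => (Real.sqrt (P.ρ ε k) : ℂ) * γ k :=
    fun γ => P.coeFn_mulOp _ _ γ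
  filter_upwards [P.coeFn_evolve ε s (P.sqrtOneAddρ ε α), P.coeFn_evolve ε s' (P.sqrtρ ε α'),
    P.coeFn_evolve ε s (P.sqrtρ ε α), P.coeFn_evolve ε s' (P.sqrtOneAddρ ε α'),
    h1 α, h1 α', h2 α, h2 α'] with k e1 e2 e3 e4 e5 e6 e7 e8
  rw [e1, e2, e3, e4, e5, e6, e7, e8]
  simp only [RCLike.inner_apply, map_mul, Complex.conj_ofReal]
  ring

/-- The one-particle vectors of the fields `φ_±(s, α)` and `φ'_±(s', α')` have a real inner
product. -/
theorem inner_evolve₁_κ_comm (ε : ℤˣ) (α α' : P.𝔥) (s s' : ℝ) :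
    ⟪P.evolve₁ ε s (P.κ ε α), P.evolve₁ ε s' (P.κ' ε α')⟫_ℂ =
      ⟪P.evolve₁ ε s' (P.κ' ε α'), P.evolve₁ ε s (P.κ ε α)⟫_ℂ := by
  have h := P.inner_evolve_sqrt ε α α' s s'
  -- In `ConjSpace` the arguments of the inner product are exchanged. With `h` and its conjugate,
  -- the two summands on one side are those on the other in reverse order.
  have h' := congrArg conj h
  rw [inner_conj_symm, inner_conj_symm] at h'
  change ⟪P.pair _ _, P.pair _ _⟫_ℂ = ⟪P.pair _ _, P.pair _ _⟫_ℂ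
  rw [inner_pair, inner_pair]
  exact (congrArg₂ (· + ·) h h'.symm).trans (add_comm _ _)

theorem inner_κ_comm (ε : ℤˣ) (α α' : P.𝔥) :
    ⟪P.κ ε α, P.κ' ε α'⟫_ℂ = ⟪P.κ' ε α', P.κ ε α⟫_ℂ := by
  simpa only [LinearIsometry.inner_map_map] using P.inner_evolve₁_κ_comm ε α α' 0 0

/-- The square root of the relation `ρ = e^{-βμ} (1 + ρ)`; it makes half a period in imaginary time
exchange the two components' weights. -/
theorem exp_mul_sqrt_one_add_ρ (ε : ℤˣ) (k : Momentum n) :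
    Real.exp (-(P.β / 2) * P.μs ε k) * Real.sqrt (1 + P.ρ ε k) = Real.sqrt (P.ρ ε k) := by
  have h : -(P.β / 2) * P.μs ε k = (-P.β * P.μs ε k) / 2 := by ring
  rw [h, Real.exp_half, ← Real.sqrt_mul (Real.exp_nonneg _), one_add_ρ, ← div_eq_mul_inv]
  rfl

theorem sharpTime_zero (ε : ℤˣ) (h0 : 0 ≤ (0 : ℝ)) (h1 : 0 ≤ P.β / 2) (α : P.𝔥) :
    P.sharpTime ε 0 h0 h1 α = P.κ ε α := by
  have hA : P.factorA ε 0 h0 = P.sqrtOneAddρ ε := P.mulOp_congr _ _ _ _ fun k => by simp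
  have hB : P.factorB ε 0 h1 = P.sqrtρ ε := P.mulOp_congr _ _ _ _ fun k => by simp
  rw [sharpTime, hA, hB, κ]

theorem sharpTime_half (ε : ℤˣ) (h0 : 0 ≤ P.β / 2) (h1 : P.β / 2 ≤ P.β / 2) (α : P.𝔥) :
    P.sharpTime ε (P.β / 2) h0 h1 α = P.κ' ε α := by
  have hA : P.factorA ε (P.β / 2) h0 = P.sqrtρ ε :=
    P.mulOp_congr _ _ _ _ fun k => by rw [exp_mul_sqrt_one_add_ρ]
  -- On the second summand `ℓ` is negative, so the exponential grows and the same relation is read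
  -- backwards.
  have hB : P.factorB ε (P.β / 2) h1 = P.sqrtOneAddρ ε :=
    P.mulOp_congr _ _ _ _ fun k => by
      rw [← exp_mul_sqrt_one_add_ρ, ← mul_assoc, ← Real.exp_add, neg_mul, add_neg_cancel,
        Real.exp_zero, one_mul]
  rw [sharpTime, hA, hB, κ']

theorem thermalField_eq (ε : ℤˣ) (s : ℝ) (α : P.𝔥) :
    P.thermalField ε s α = fieldOp (P.evolve₁ ε s (P.κ ε α)) :=
  P.sandwich_expL_fieldOp ε s _

theorem thermalField'_eq (ε : ℤˣ) (s : ℝ) (α : P.𝔥) :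
    P.thermalField' ε s α = fieldOp (P.evolve₁ ε s (P.κ' ε α)) :=
  P.sandwich_expL_fieldOp ε s _

theorem quantizedFieldZero_eq (ε : ℤˣ) (α : P.𝔥) :
    P.quantizedFieldZero ε α = fieldOp (P.κ ε α) :=
  congrArg fieldOp (P.sharpTime_zero ε _ _ α)

theorem quantizedFieldHalf_eq (ε : ℤˣ) (α : P.𝔥) :
    P.quantizedFieldHalf ε α = fieldOp (P.κ' ε α) :=
  congrArg fieldOp (P.sharpTime_half ε _ _ α)

theorem algebraZero_eq (ε : ℤˣ) : P.algebraZero ε =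
    generatedAlgebra (fieldOp '' Set.range fun x : ℝ × P.𝔥 => P.evolve₁ ε x.1 (P.κ ε x.2)) := by
  unfold algebraZero
  congr 1
  ext A
  simp [thermalField_eq, eq_comm]

theorem algebraHalf_eq (ε : ℤˣ) : P.algebraHalf ε =
    generatedAlgebra (fieldOp '' Set.range fun x : ℝ × P.𝔥 => P.evolve₁ ε x.1 (P.κ' ε x.2)) := by
  unfold algebraHalf
  congr 1
  ext A
  simp [thermalField'_eq, eq_comm]

end Params

end ThermalField

end

open ThermalField in
theorem mainTheorem10 {n : ℕ} (P : Params n) (ε : ℤˣ) :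
    (∀ (α α' : P.𝔥) (s s' : ℝ),
      CommuteOn (finiteVectors P.H₁)
        (P.thermalField ε (-s) (P.conjugate α)) (P.thermalField' ε s' α')) ∧
    (∀ (α α' : P.𝔥) (s s' : ℝ),
      CommuteOn (finiteVectors P.H₁)
        (P.complexLinear (P.thermalField ε (-s)) (P.conjugate α))
        (P.complexLinear (P.thermalField' ε s') α')) ∧
    (∀ α α' : P.𝔥,
      CommuteOn (finiteVectors P.H₁) (P.quantizedFieldZero ε α) (P.quantizedFieldHalf ε α')) ∧
    (∀ α α' : P.𝔥,
      CommuteOn (finiteVectors P.H₁)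
        (P.complexLinear (P.quantizedFieldZero ε) α)
        (P.complexLinear (P.quantizedFieldHalf ε) α')) ∧
    (∀ A ∈ P.algebraZero ε, ∀ B ∈ P.algebraHalf ε, A * B = B * A) := by
  refine ⟨fun α α' s s' => ?_, fun α α' s s' => ?_, fun α α' => ?_, fun α α' => ?_,
    fun A hA B hB => ?_⟩
  · rw [P.thermalField_eq, P.thermalField'_eq]
    exact commuteOn_fieldOp (P.inner_evolve₁_κ_comm ε _ _ _ _)
  · simp only [Params.complexLinear, P.thermalField_eq, P.thermalField'_eq]
    exact commuteOn_fieldOp_add_smul (P.inner_evolve₁_κ_comm ε _ _ _ _)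
      (P.inner_evolve₁_κ_comm ε _ _ _ _) (P.inner_evolve₁_κ_comm ε _ _ _ _)
      (P.inner_evolve₁_κ_comm ε _ _ _ _) _
  · rw [P.quantizedFieldZero_eq, P.quantizedFieldHalf_eq]
    exact commuteOn_fieldOp (P.inner_κ_comm ε _ _)
  · simp only [Params.complexLinear, P.quantizedFieldZero_eq, P.quantizedFieldHalf_eq]
    exact commuteOn_fieldOp_add_smul (P.inner_κ_comm ε _ _) (P.inner_κ_comm ε _ _)
      (P.inner_κ_comm ε _ _) (P.inner_κ_comm ε _ _) _
  · rw [P.algebraZero_eq] at hA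
    rw [P.algebraHalf_eq] at hB
    refine generatedAlgebra_commute ?_ hA hB
    rintro _ ⟨x, rfl⟩ _ ⟨y, rfl⟩
    exact P.inner_evolve₁_κ_comm ε _ _ _ _
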